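/- Let $n\ge 1$. Let $\mathrm{Conv}_c(\mathbb R^n)$ be the set of convex functions $\psi:\mathbb R^n\to(-\infty,\infty]$ that are coercive ($\psi(x)\to\infty$ as $|x|\to\infty$), proper and lower semicontinuous, and let $\mathrm{LC}_c(\mathbb R^n)=\{e^{-\psi}:\psi\in\mathrm{Conv}_c(\mathbb R^n)\}$. For $\psi:\mathbb R^n\to(-\infty,\infty]$ write $\mathcal L\psi(x)=\sup_{y}(\langle x,y\rangle-\psi(y))$ for the convex conjugate and $\mathrm{dom}\,\psi=\{\psi<\infty\}$. *Outer linearizations.* For $\psi\in\mathrm{Conv}_c(\mathbb R^n)$ and $y\in\mathbb R^n$, let $\ell_{\psi,y}(x)=\langle x,y\rangle+c$, where $c\in[-\infty,\infty)$ is the largest number with $\ell_{\psi,y}\le\psi$ ($c=-\infty$ if no real $c$ works), and for $Y\subseteq\mathbb R^n$ put $q_{\psi,Y}=\sup_{y\in Y}\ell_{\psi,y}$. Let $r(\psi)=\sup\{r\ge 0: rB_n\subseteq\mathrm{dom}\,\mathcal L\psi\}\in(0,\infty]$, where $B_n$ is the closed Euclidean unit ball, and let $\mathscr Y_\psi$ be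 the family of all $Y\subseteq\mathbb R^n$ that have a subset $Y_o\subseteq\{x:|x|<r(\psi)\}$ whose positive hull is $\mathbb R^n$. *Symmetrization.* For $n\ge 2$, $\psi_{\rm rot}\in\mathrm{Conv}_c(\mathbb R^n)$ is the unique function with $\mathcal L\psi_{\rm rot}(x)=\int_{\mathrm{SO}(n)}\mathcal L\psi(\vartheta^{-1}x)\,d\vartheta$ for all $x$ (Haar probability measure). For $n=1$, $\psi_{\rm rot}(x)=\frac12\inf_{y\in\mathbb R}\big(\psi(2x-y)+\psi(-y)\big)$. For $f=e^{-\psi}$ put $f_{\rm rot}=e^{-\psi_{\rm rot}}$. *Functionals.* Let $F:\mathrm{LC}_c(\mathbb R^n)\to[0,\infty]$ be a functional that does not attain both values $0$ and $\infty$. Assume that $F$ is - upper semicontinuous: $\limsup_j F(f_j)\le F(f)$ whenever $f_j,f\in\mathrm{LC}_c(\mathbb R^n)$ and $f_j$ hypo-converges to $f$, i.e. for every $x$, $\limsup_j f_j(x_j)\le f(x)$ for every sequence $x_j\to x$ and $f_j(x_j)\to f(x)$ for some sequence $x_j\to x$; - log-concave: $F(\lambda\cdot f\star(1-\lambda)\cdot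 g)\ge F(f)^{\lambda}F(g)^{1-\lambda}$ for all $f,g\in\mathrm{LC}_c(\mathbb R^n)$ and $\lambda\in(0,1)$, where $(f\star g)(x)=\sup_y f(y)g(x-y)$ and $(\lambda\cdot f)(x)=f(x/\lambda)^\lambda$; - monotone increasing: $F(f)\le F(g)$ whenever $f\le g$. For $f=e^{-\psi}\in\mathrm{LC}_c(\mathbb R^n)$ and $\mathcal Y\subseteq\mathscr Y_\psi$ put $$F^*(f,\mathcal Y)=\inf\{F(e^{-q_{\psi\circ\vartheta^{-1},Y}}):\ \vartheta\in G_n,\ Y\in\mathcal Y\},$$ where $G_n=\mathrm{SO}(n)$ if $n\ge 2$ and $G_1=\mathrm O(1)=\{\pm1\}$; the infimum over the empty set is $\infty$. **Theorem.** For every $f=e^{-\psi}\in\mathrm{LC}_c(\mathbb R^n)$ and every $\mathcal Y\subseteq\mathscr Y_\psi$, $$F^*(f,\mathcal Y)\le F^*(f_{\rm rot},\mathcal Y).$$ Moreover, these expressions are well defined: $\psi_{\rm rot}\in\mathrm{Conv}_c(\mathbb R^n)$ exists with the property above, so that $f_{\rm rot}\in\mathrm{LC}_c(\mathbb R^n)$;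 $\mathcal Y\subseteq\mathscr Y_{\psi_{\rm rot}}$; and $e^{-q_{\psi\circ\vartheta^{-1},Y}}$ and $e^{-q_{\psi_{\rm rot}\circ\vartheta^{-1},Y}}$ belong to $\mathrm{LC}_c(\mathbb R^n)$ for all $Y\in\mathcal Y$ and $\vartheta\in\mathrm O(n)$. -/

import Mathlib

open Set Filter Topology MeasureTheory
open scoped ENNReal NNReal

noncomputable section

namespace OuterLin

/-- Euclidean space `ℝⁿ`. -/
abbrev E (n : ℕ) : Type := EuclideanSpace ℝ (Fin n)

/-! ### Coercive convex functions -/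

/-- The class `Conv_c(ℝⁿ)` of convex functions `ψ : ℝⁿ → (-∞, ∞]` that are coercive, proper and
lower semicontinuous. Convexity is convexity of the epigraph. -/
structure IsConvC {n : ℕ} (ψ : E n → EReal) : Prop where
  ne_bot : ∀ x, ψ x ≠ ⊥
  convex : Convex ℝ {p : E n × ℝ | ψ p.1 ≤ (p.2 : EReal)}
  coercive : Tendsto ψ (Bornology.cobounded (E n)) (𝓝 ⊤)
  proper : ∃ x, ψ x ≠ ⊤
  lsc : LowerSemicontinuous ψ

/-- Infimal convolution (epi-sum) of two functions with values in `(-∞, ∞]`. -/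
def infConv {n : ℕ} (ψ₁ ψ₂ : E n → EReal) : E n → EReal :=
  fun x => ⨅ y : E n, ψ₁ (x - y) + ψ₂ y

/-- Epi-multiplication `(c ∙ ψ)(x) = c ψ(x / c)` for `c > 0`. -/
def epiMul {n : ℕ} (c : ℝ) (ψ : E n → EReal) : E n → EReal :=
  fun x => (c : EReal) * ψ (c⁻¹ • x)

/-- The convex conjugate (Legendre--Fenchel transform). -/
def conj {n : ℕ} (ψ : E n → EReal) : E n → EReal :=
  fun x => ⨆ y : E n, ((inner ℝ x y : ℝ) : EReal) - ψ y

/-- The domain `{ψ < ∞}`. -/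
def dom {n : ℕ} (ψ : E n → EReal) : Set (E n) := {x | ψ x < ⊤}

/-- `r(ψ) = sup {r ≥ 0 : r Bₙ ⊆ dom (conj ψ)} ∈ [0, ∞]`. -/
def innerRadius {n : ℕ} (ψ : E n → EReal) : ℝ≥0∞ :=
  ⨆ r ∈ {r : ℝ≥0 | Metric.closedBall (0 : E n) r ⊆ dom (conj ψ)}, (r : ℝ≥0∞)

/-- The open centred ball of radius `r(ψ)`; it is the whole space if `r(ψ) = ∞`. -/
def openInnerBall {n : ℕ} (ψ : E n → EReal) : Set (E n) := {x | ‖x‖ₑ < innerRadius ψ}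

/-- The family `𝒴_ψ` of admissible slope sets: those `Y ⊆ ℝⁿ` having a subset `Y₀` that lies in the
open centred ball of radius `r(ψ)` and whose positive hull is `ℝⁿ`. -/
def admissible {n : ℕ} (ψ : E n → EReal) : Set (Set (E n)) :=
  {Y | ∃ Y₀ ⊆ Y, PointedCone.hull ℝ Y₀ = ⊤ ∧ Y₀ ⊆ openInnerBall ψ}

/-- `c_ψ(y) ∈ [-∞, ∞]`: the largest `c` such that `⟨·, y⟩ + c ≤ ψ`, and `-∞` if there is none. -/
def maxIntercept {n : ℕ} (ψ : E n → EReal) (y : E n) : EReal :=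
  ⨆ c ∈ {c : ℝ | ∀ x : E n, ((inner ℝ x y + c : ℝ) : EReal) ≤ ψ x}, (c : EReal)

/-- `ℓ_{ψ,y}`: the largest affine minorant of `ψ` with slope `y` (or `-∞` if there is none). -/
def affMinorant {n : ℕ} (ψ : E n → EReal) (y : E n) : E n → EReal :=
  fun x => ((inner ℝ x y : ℝ) : EReal) + maxIntercept ψ y

/-- The generalized outer linearization `q_{ψ,Y} = sup_{y ∈ Y} ℓ_{ψ,y}`. -/
def outerLin {n : ℕ} (ψ : E n → EReal) (Y : Set (E n)) : E n → EReal :=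
  fun x => ⨆ y ∈ Y, affMinorant ψ y x

/-! ### Rotations and the Haar measure of `SO(n)` -/

/-- The special orthogonal group `SO(n)`. -/
abbrev SO (n : ℕ) := Matrix.specialOrthogonalGroup (Fin n) ℝ

/-- `ψ ∘ ϑ⁻¹` for an (orthogonal) matrix `ϑ`. -/
def rotate {n : ℕ} (ϑ : Matrix (Fin n) (Fin n) ℝ) (ψ : E n → EReal) : E n → EReal :=
  fun x => ψ (Matrix.toEuclideanLin ϑ⁻¹ x)

/-- The matrices over which the extremal problem is posed: `SO(n)` if `n ≥ 2`, and
`O(1) = {1, -1}` if `n = 1`. -/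
def motions (n : ℕ) : Set (Matrix (Fin n) (Fin n) ℝ) :=
  if n = 1 then Matrix.orthogonalGroup (Fin n) ℝ else Matrix.specialOrthogonalGroup (Fin n) ℝ

instance instIsTopologicalGroupSO (n : ℕ) : IsTopologicalGroup (SO n) where
  continuous_inv := by
    refine Continuous.subtype_mk (f := fun A : SO n => star (A : Matrix (Fin n) (Fin n) ℝ)) ?_ _
    exact Continuous.matrix_conjTranspose continuous_subtype_val

instance instCompactSpaceSO (n : ℕ) : CompactSpace (SO n) := by
  suffices h : IsCompact ((Matrix.specialOrthogonalGroup (Fin n) ℝ : Submonoid _) :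
      Set (Matrix (Fin n) (Fin n) ℝ)) from isCompact_iff_compactSpace.mp h
  have hK : IsCompact (Set.univ.pi fun _ : Fin n => Set.univ.pi fun _ : Fin n =>
      Set.Icc (-1 : ℝ) 1) :=
    isCompact_univ_pi fun _ => isCompact_univ_pi fun _ => isCompact_Icc
  have hcl : IsClosed {A : Matrix (Fin n) (Fin n) ℝ | A * A.transpose = 1 ∧ A.det = 1} :=
    (isClosed_eq (continuous_id.matrix_mul continuous_id.matrix_transpose)
      continuous_const).inter (isClosed_eq continuous_id.matrix_det continuous_const)
  have heq : ((Matrix.specialOrthogonalGroup (Fin n) ℝ : Submonoid _) :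
      Set (Matrix (Fin n) (Fin n) ℝ)) =
      {A : Matrix (Fin n) (Fin n) ℝ | A * A.transpose = 1 ∧ A.det = 1} := by
    ext A
    rw [SetLike.mem_coe, Matrix.mem_specialOrthogonalGroup_iff, Matrix.mem_orthogonalGroup_iff]
    rfl
  refine IsCompact.of_isClosed_subset hK ?_ ?_
  · rw [heq]
    exact hcl
  · intro A hA i _ j _
    have h := entry_norm_bound_of_unitary
      (Matrix.mem_specialOrthogonalGroup_iff.mp hA).1 i j
    exact abs_le.mp h

instance instMeasurableSpaceSO (n : ℕ) : MeasurableSpace (SO n) := borel _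

instance instBorelSpaceSO (n : ℕ) : BorelSpace (SO n) := ⟨rfl⟩

/-- The Haar probability measure on `SO(n)`. -/
def haarSO (n : ℕ) : Measure (SO n) := Measure.haarMeasure ⊤

instance isProbabilityMeasure_haarSO (n : ℕ) : IsProbabilityMeasure (haarSO n) :=
  ⟨Measure.haarMeasure_self (K₀ := (⊤ : TopologicalSpace.PositiveCompacts (SO n)))⟩

/-- The integral of an extended-real function: integral of the positive part minus integral of the
negative part. -/
def extIntegral {Ω : Type*} [MeasurableSpace Ω] (μ : Measure Ω) (g : Ω → EReal) : EReal :=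
  ((∫⁻ ω, (g ω).toENNReal ∂μ : ℝ≥0∞) : EReal) - ((∫⁻ ω, (-g ω).toENNReal ∂μ : ℝ≥0∞) : EReal)

/-- `x ↦ ∫_{SO(n)} (conj ψ)(ϑ⁻¹ x) dϑ`. -/
def conjMean {n : ℕ} (ψ : E n → EReal) : E n → EReal :=
  fun x => extIntegral (haarSO n)
    (fun ϑ : SO n => rotate (ϑ : Matrix (Fin n) (Fin n) ℝ) (conj ψ) x)

/-- The rotational epi-symmetrization `ψ_rot`. For `n = 1` it is `½ ∙ (ψ □ ψ(-·))`; for `n ≥ 2` it is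
the function whose conjugate is `conjMean ψ`. -/
def epiRot {n : ℕ} (ψ : E n → EReal) : E n → EReal :=
  if n = 1 then epiMul (1 / 2) (infConv ψ (fun x => ψ (-x))) else conj (conjMean ψ)

/-! ### Log-concave functions -/

/-- `e^{-ψ}`, with `e^{-∞} = 0`. -/
def expNeg {n : ℕ} (ψ : E n → EReal) : E n → ℝ≥0∞ := fun x => EReal.exp (-ψ x)

/-- `-log f`, the inverse of `expNeg`. -/
def negLog {n : ℕ} (f : E n → ℝ≥0∞) : E n → EReal := fun x => -ENNReal.log (f x)

theorem negLog_expNeg {n : ℕ} (ψ : E n → EReal) : negLog (expNeg ψ) = ψ := by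
  funext x
  simp [negLog, expNeg]

/-- The class `LC_c(ℝⁿ) = {e^{-ψ} : ψ ∈ Conv_c(ℝⁿ)}`; its members have values in `[0, ∞)`. -/
def LCc (n : ℕ) : Set (E n → ℝ≥0∞) := {f | ∃ ψ : E n → EReal, IsConvC ψ ∧ f = expNeg ψ}

/-- The Asplund sum (supremal convolution) `f ⋆ g`. -/
def asplund {n : ℕ} (f g : E n → ℝ≥0∞) : E n → ℝ≥0∞ := fun x => ⨆ y : E n, f y * g (x - y)

/-- The homothety `(c · f)(x) = f(x / c) ^ c` for `c > 0`. -/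
def homothety {n : ℕ} (c : ℝ) (f : E n → ℝ≥0∞) : E n → ℝ≥0∞ := fun x => f (c⁻¹ • x) ^ c

/-- Hypo-convergence of a sequence of functions. -/
def HypoTendsto {n : ℕ} (fs : ℕ → E n → ℝ≥0∞) (f : E n → ℝ≥0∞) : Prop :=
  ∀ x : E n,
    (∀ xs : ℕ → E n, Tendsto xs atTop (𝓝 x) → limsup (fun j => fs j (xs j)) atTop ≤ f x) ∧
    (∃ xs : ℕ → E n, Tendsto xs atTop (𝓝 x) ∧ Tendsto (fun j => fs j (xs j)) atTop (𝓝 (f x)))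

/-- Upper semicontinuity of a functional on `LC_c(ℝⁿ)` with respect to hypo-convergence. -/
def HypoUSC {n : ℕ} (F : (E n → ℝ≥0∞) → ℝ≥0∞) : Prop :=
  ∀ (fs : ℕ → E n → ℝ≥0∞) (f : E n → ℝ≥0∞), (∀ j, fs j ∈ LCc n) → f ∈ LCc n →
    HypoTendsto fs f → limsup (fun j => F (fs j)) atTop ≤ F f

/-- Log-concavity of a functional on `LC_c(ℝⁿ)` with respect to the Asplund sum. -/
def AsplundLogConcave {n : ℕ} (F : (E n → ℝ≥0∞) → ℝ≥0∞) : Prop :=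
  ∀ f ∈ LCc n, ∀ g ∈ LCc n, ∀ c : ℝ, 0 < c → c < 1 →
    F f ^ c * F g ^ (1 - c) ≤ F (asplund (homothety c f) (homothety (1 - c) g))

/-- The rotational hypo-symmetrization `f_rot = e^{-ψ_rot}` of `f = e^{-ψ}`. -/
def hypoRot {n : ℕ} (f : E n → ℝ≥0∞) : E n → ℝ≥0∞ := expNeg (epiRot (negLog f))

/-- `F*(f, 𝒴) = inf {F(e^{-q_{ψ ∘ ϑ⁻¹, Y}}) : ϑ, Y ∈ 𝒴}` for `f = e^{-ψ}`, where `ϑ` ranges over `SO(n)`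
if `n ≥ 2` and over `O(1)` if `n = 1`. -/
def Fstar {n : ℕ} (F : (E n → ℝ≥0∞) → ℝ≥0∞) (f : E n → ℝ≥0∞) (𝒴 : Set (Set (E n))) : ℝ≥0∞ :=
  ⨅ ϑ ∈ motions n, ⨅ Y ∈ 𝒴, F (expNeg (outerLin (rotate ϑ (negLog f)) Y))

end OuterLin

end

noncomputable section

namespace OuterLin

/-! ### Extended real inequalities and semicontinuity -/

/-! The largest intercept of an affine minorant of `ψ` with slope `y` is `-conj ψ y`
(`maxIntercept_eq`), so an outer linearization sees `ψ` only through the values of `conj ψ` on `Y`.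
For finitely many slopes `p i` it is the maximum of `⟨·, p i⟩ - g i`, a function of a vector `g ∈
ℝᵐ`. If the slopes positively span, then `{g | c ≤ F(e^{-max})}` is convex by log-concavity and
monotonicity (`convex_superlevel`) and closed by upper semicontinuity (`isClosed_superlevel`).

Fix a motion `ϑ` and finitely many slopes at which the conjugate of `ψ_rot ∘ ϑ⁻¹` is finite. The
vector of these values is the mean over `ρ` of the vectors with entries `conj ψ (ρ⁻¹ ϑ⁻¹ p i)`, the
values for `ψ ∘ (ϑ ρ)⁻¹`. Using only some slopes of `Y` lowers the linearization and hence raises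
`F`, so almost every vector being averaged lies in the superlevel set with `c = F*(f, 𝒴)`. A mean
over a probability measure cannot leave a closed convex set (`IsMotionMean`), so the vector of
`ψ_rot` lies there too. This settles finite slope sets (`Fstar_le_of_isMotionMean`). A general `Y`
is the increasing limit of finite subfamilies, and upper semicontinuity carries the bound over
(`le_functional_outerLin`).

Well-definedness rests on two facts. The mean of `conj ψ` is again closed and convex, with lower
semicontinuity from Fatou's lemma, so Fenchel–Moreau identifies it with the conjugate of `ψ_rot`.
Bounds of `conj ψ` on centred balls pass to the mean, so `r(ψ) ≤ r(ψ_rot)` and admissible slope sets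
stay admissible. -/

theorem coe_sub_le_coe_iff (c r : ℝ) (v : EReal) :
    (c : EReal) - v ≤ (r : EReal) ↔ ((c - r : ℝ) : EReal) ≤ v := by
  induction v with
  | bot =>
    rw [EReal.coe_sub_bot, top_le_iff, le_bot_iff]
    exact iff_of_false (EReal.coe_ne_top r) (EReal.coe_ne_bot _)
  | top => simp
  | coe v => norm_cast; constructor <;> intro h <;> linarith

theorem eq_of_forall_le_coe_iff {a b : EReal}
    (h : ∀ r : ℝ, a ≤ (r : EReal) ↔ b ≤ (r : EReal)) : a = b :=
  le_antisymm (EReal.le_of_forall_lt_iff_le.1 fun z hz => (h z).2 hz.le)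
    (EReal.le_of_forall_lt_iff_le.1 fun z hz => (h z).1 hz.le)

theorem lowerSemicontinuous_of_isClosed_le_coe {X : Type*} [TopologicalSpace X] {f : X → EReal}
    (h : ∀ t : ℝ, IsClosed {x | f x ≤ (t : EReal)}) : LowerSemicontinuous f := by
  rw [lowerSemicontinuous_iff_isClosed_preimage]
  intro y
  have : f ⁻¹' Iic y = ⋂ (t : ℝ) (_ : y < (t : EReal)), {x | f x ≤ (t : EReal)} := by
    ext x
    simp only [mem_preimage, mem_Iic, mem_iInter, mem_ofPred_eq]
    exact EReal.le_of_forall_lt_iff_le.symm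
  rw [this]
  exact isClosed_iInter fun t => isClosed_iInter fun _ => h t

/-! ### Characterization of `Conv_c` by compact sublevel sets -/

variable {n : ℕ}

/-- Closed sublevel sets give lower semicontinuity and bounded ones give coercivity, so compactness
is a single test for both. -/
theorem IsConvC.of_isCompact {ψ : E n → EReal} (hbot : ∀ x, ψ x ≠ ⊥)
    (hconv : Convex ℝ {p : E n × ℝ | ψ p.1 ≤ (p.2 : EReal)}) (hproper : ∃ x, ψ x ≠ ⊤)
    (hcomp : ∀ t : ℝ, IsCompact {x | ψ x ≤ (t : EReal)}) : IsConvC ψ where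
  ne_bot := hbot
  convex := hconv
  proper := hproper
  lsc := lowerSemicontinuous_of_isClosed_le_coe fun t => (hcomp t).isClosed
  coercive := by
    rw [EReal.tendsto_nhds_top_iff_real]
    intro t
    have := (hcomp t).isBounded
    rw [← Bornology.isCobounded_compl_iff] at this
    filter_upwards [this] with x hx
    simpa using hx

theorem IsConvC.isCompact_le {ψ : E n → EReal} (hψ : IsConvC ψ) (t : ℝ) :
    IsCompact {x | ψ x ≤ (t : EReal)} := by
  refine Metric.isCompact_of_isClosed_isBounded (hψ.lsc.isClosed_preimage (t : EReal)) ?_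
  rw [← Bornology.isCobounded_compl_iff]
  filter_upwards [EReal.tendsto_nhds_top_iff_real.1 hψ.coercive t] with x hx
  simpa using hx

theorem IsConvC.exists_coe {ψ : E n → EReal} (hψ : IsConvC ψ) : ∃ x, ∃ r : ℝ, ψ x = r := by
  obtain ⟨x, hx⟩ := hψ.proper
  exact ⟨x, (ψ x).toReal, (EReal.coe_toReal hx (hψ.ne_bot x)).symm⟩

theorem IsConvC.exists_lower_bound {ψ : E n → EReal} (hψ : IsConvC ψ) :
    ∃ m : ℝ, ∀ x, (m : EReal) ≤ ψ x := by
  obtain ⟨x₀, r, hr⟩ := hψ.exists_coe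
  obtain ⟨a, ha, hmin⟩ := LowerSemicontinuousOn.exists_isMinOn (s := {x | ψ x ≤ (r : EReal)})
    ⟨x₀, hr.le⟩ (hψ.isCompact_le r) (hψ.lsc.lowerSemicontinuousOn _)
  have hatop : ψ a ≠ ⊤ := (lt_of_le_of_lt ha (EReal.coe_lt_top r)).ne
  refine ⟨(ψ a).toReal, fun x => ?_⟩
  rw [EReal.coe_toReal hatop (hψ.ne_bot a)]
  by_cases hx : ψ x ≤ (r : EReal)
  · exact hmin hx
  · exact ha.trans (not_le.1 hx).le

theorem coe_combo_le {ψ : E n → EReal} (hψ : Convex ℝ {p : E n × ℝ | ψ p.1 ≤ (p.2 : EReal)})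
    {x y : E n} {r s a b : ℝ} (hx : ψ x ≤ (r : EReal)) (hy : ψ y ≤ (s : EReal)) (ha : 0 ≤ a)
    (hb : 0 ≤ b) (hab : a + b = 1) : ψ (a • x + b • y) ≤ ((a * r + b * s : ℝ) : EReal) := by
  have := hψ (x := (x, r)) hx (y := (y, s)) hy ha hb hab
  simpa using this

/-- Coercive convex functions grow at least linearly. -/
theorem IsConvC.exists_linear_growth {ψ : E n → EReal} (hψ : IsConvC ψ) :
    ∃ δ > 0, ∃ M : ℝ, ∀ x, ((δ * ‖x‖ - M : ℝ) : EReal) ≤ ψ x := by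
  obtain ⟨x₀, s, hs⟩ := hψ.exists_coe
  obtain ⟨m, hm⟩ := hψ.exists_lower_bound
  obtain ⟨R, hR⟩ := (hψ.isCompact_le (s + 1)).isBounded.subset_closedBall x₀
  set R' := max R 1 with hR'
  have hR'pos : 0 < R' := lt_of_lt_of_le one_pos (le_max_right _ _)
  have hms : m ≤ s := by have := hm x₀; rw [hs] at this; exact_mod_cast this
  -- If the bound fails at `x`, then `m ≤ ψ x` puts `x` at distance at least `2R'` from `x₀`. By
  -- convexity the point of the segment `[x₀, x]` at distance exactly `2R'` has value at most `s +
  -- 1`, although that sublevel set lies within distance `R ≤ R'`.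
  refine ⟨(2 * R')⁻¹, by positivity, ‖x₀‖ / (2 * R') - m + 1, fun x => ?_⟩
  have hnorm : ‖x‖ ≤ ‖x - x₀‖ + ‖x₀‖ := by
    simpa using norm_add_le (x - x₀) x₀
  by_contra hcon
  push Not at hcon
  have htri : (2 * R')⁻¹ * ‖x‖ ≤ (2 * R')⁻¹ * ‖x - x₀‖ + ‖x₀‖ / (2 * R') := by
    rw [div_eq_inv_mul, ← mul_add]
    gcongr
  have hlt : ψ x ≤ (((2 * R')⁻¹ * ‖x - x₀‖ + m - 1 : ℝ) : EReal) :=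
    hcon.le.trans (by norm_cast; linarith)
  have hbig : 2 * R' ≤ ‖x - x₀‖ := by
    have h1 : m ≤ (2 * R')⁻¹ * ‖x - x₀‖ + m - 1 := by exact_mod_cast (hm x).trans hlt
    have h2 : 1 ≤ (2 * R')⁻¹ * ‖x - x₀‖ := by linarith
    rwa [inv_mul_eq_div, one_le_div (by positivity)] at h2
  set τ := 2 * R' / ‖x - x₀‖ with hτ
  have hd : 0 < ‖x - x₀‖ := by linarith
  have hτ0 : 0 ≤ τ := by positivity
  have hτ1 : τ ≤ 1 := by rw [hτ, div_le_one hd]; exact hbig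
  have hcombo := coe_combo_le hψ.convex hs.le hlt (sub_nonneg.2 hτ1) hτ0 (by ring)
  have hval : (1 - τ) * s + τ * ((2 * R')⁻¹ * ‖x - x₀‖ + m - 1) ≤ s + 1 := by
    have : τ * ((2 * R')⁻¹ * ‖x - x₀‖) = 1 := by rw [hτ]; field_simp
    nlinarith
  have hmem := hR (show (1 - τ) • x₀ + τ • x ∈ _ from
    hcombo.trans (by exact_mod_cast hval))
  have : (1 - τ) • x₀ + τ • x - x₀ = τ • (x - x₀) := by module
  rw [Metric.mem_closedBall, dist_eq_norm, this, norm_smul, Real.norm_of_nonneg hτ0, hτ,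
    div_mul_cancel₀ _ hd.ne'] at hmem
  have := le_max_left R 1
  linarith

/-! ### Suprema of affine functions -/

/-- The supremum of the affine functions `⟨·, z i⟩ - g i`. -/
def affineSup {ι : Type*} (z : ι → E n) (g : ι → EReal) : E n → EReal :=
  fun x => ⨆ i, ((inner ℝ x (z i) : ℝ) : EReal) - g i

/-- Testing against real levels avoids arithmetic with infinities. It covers conjugates (`z = id`),
outer linearizations (`z` the inclusion of `Y`) and finite maxima alike. -/
theorem affineSup_le_coe_iff {ι : Type*} (z : ι → E n) (g : ι → EReal) (x : E n) (r : ℝ) :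
    affineSup z g x ≤ (r : EReal) ↔ ∀ i, ((inner ℝ x (z i) - r : ℝ) : EReal) ≤ g i := by
  simp only [affineSup, iSup_le_iff, coe_sub_le_coe_iff]

theorem conj_le_coe_iff (ψ : E n → EReal) (x : E n) (r : ℝ) :
    conj ψ x ≤ (r : EReal) ↔ ∀ y, ((inner ℝ x y - r : ℝ) : EReal) ≤ ψ y :=
  affineSup_le_coe_iff id ψ x r

theorem coe_le_of_conj_le_coe {ψ : E n → EReal} {x y : E n} {r s : ℝ} (h : conj ψ x ≤ (r : EReal))
    (hs : ψ y ≤ (s : EReal)) : inner ℝ x y ≤ r + s := by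
  have := ((conj_le_coe_iff ψ x r).1 h y).trans hs
  norm_cast at this
  linarith

theorem convex_affineSup {ι : Type*} (z : ι → E n) (g : ι → EReal) :
    Convex ℝ {p : E n × ℝ | affineSup z g p.1 ≤ (p.2 : EReal)} := by
  simp only [affineSup_le_coe_iff, ofPred_forall]
  refine convex_iInter fun i => ?_
  rintro ⟨x, r⟩ hx ⟨y, s⟩ hy a b ha hb hab
  simp only [mem_ofPred_eq] at hx hy ⊢
  induction hg : g i with
  | bot =>
    rw [hg, le_bot_iff] at hx
    exact absurd hx (EReal.coe_ne_bot _)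
  | top => exact le_top
  | coe v =>
    rw [hg] at hx hy
    norm_cast at hx hy ⊢
    simp only [Prod.smul_mk, Prod.mk_add_mk, inner_add_left, real_inner_smul_left, smul_eq_mul]
    have h1 := mul_le_mul_of_nonneg_left hx ha
    have h2 := mul_le_mul_of_nonneg_left hy hb
    have h3 : a * v + b * v = v := by rw [← add_mul, hab, one_mul]
    linarith

theorem isClosed_affineSup_le {ι : Type*} (z : ι → E n) (g : ι → EReal) (t : ℝ) :
    IsClosed {x | affineSup z g x ≤ (t : EReal)} := by
  simp only [affineSup_le_coe_iff, ofPred_forall]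
  refine isClosed_iInter fun i => isClosed_le ?_ continuous_const
  exact continuous_coe_real_ereal.comp (by fun_prop)

/-- By `hgrow`, each direction has a slope of controlled intercept, so the supremum is at least
`δ‖x‖ - M` and its sublevel sets are bounded. -/
theorem isConvC_affineSup {ι : Type*} (z : ι → E n) (g : ι → EReal)
    (hproper : ∃ x, affineSup z g x ≠ ⊤) {δ : ℝ} (hδ : 0 < δ) {M : ℝ}
    (hgrow : ∀ x, ∃ i, g i ≤ (M : EReal) ∧ δ * ‖x‖ ≤ inner ℝ x (z i)) :
    IsConvC (affineSup z g) := by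
  have hlow : ∀ x, ((δ * ‖x‖ - M : ℝ) : EReal) ≤ affineSup z g x := by
    intro x
    obtain ⟨i, hi, hx⟩ := hgrow x
    refine le_trans ?_ (le_iSup (fun i => ((inner ℝ x (z i) : ℝ) : EReal) - g i) i)
    rw [EReal.coe_sub]
    exact EReal.sub_le_sub (by exact_mod_cast hx) hi
  refine IsConvC.of_isCompact (fun x hx => ?_) (convex_affineSup z g) hproper fun t => ?_
  · have := hlow x
    rw [hx, le_bot_iff] at this
    exact EReal.coe_ne_bot _ this
  · refine Metric.isCompact_of_isClosed_isBounded (isClosed_affineSup_le z g t) ?_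
    refine (Metric.isBounded_closedBall (x := (0 : E n)) (r := (t + M) / δ)).subset fun x hx => ?_
    have := (hlow x).trans hx
    norm_cast at this
    rw [mem_closedBall_zero_iff, le_div_iff₀ hδ]
    linarith

theorem conj_ne_bot {ψ : E n → EReal} (hψ : ∃ x, ψ x ≠ ⊤) (y : E n) : conj ψ y ≠ ⊥ := by
  obtain ⟨x, hx⟩ := hψ
  intro h
  have h1 : ((inner ℝ y x : ℝ) : EReal) - ψ x ≤ ⊥ :=
    h ▸ le_iSup (fun x => ((inner ℝ y x : ℝ) : EReal) - ψ x) x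
  have h2 : ψ x ≤ (((ψ x).toReal : ℝ) : EReal) := EReal.le_coe_toReal hx
  have h3 := (EReal.sub_le_sub (le_refl ((inner ℝ y x : ℝ) : EReal)) h2).trans h1
  rw [← EReal.coe_sub, le_bot_iff] at h3
  exact EReal.coe_ne_bot _ h3

/-- Boundedness of `φ` near the origin makes the conjugate grow linearly, as the slope `(δ/‖x‖) x`
shows; an affine minorant of `φ` makes it proper. -/
theorem isConvC_conj {φ : E n → EReal} {δ M : ℝ} (hδ : 0 < δ)
    (hball : ∀ y, ‖y‖ ≤ δ → φ y ≤ (M : EReal)) {a : E n} {b : ℝ}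
    (hmin : ∀ y, ((inner ℝ a y - b : ℝ) : EReal) ≤ φ y) : IsConvC (conj φ) := by
  refine isConvC_affineSup id φ ⟨a, ?_⟩ hδ (M := M) fun x => ?_
  · have : conj φ a ≤ (b : EReal) := (conj_le_coe_iff φ a b).2 hmin
    exact (this.trans_lt (EReal.coe_lt_top b)).ne
  · rcases eq_or_ne x 0 with rfl | hx
    · exact ⟨0, hball 0 (by simpa using hδ.le), by simp⟩
    · have hx' : 0 < ‖x‖ := norm_pos_iff.2 hx
      refine ⟨(δ / ‖x‖) • x, hball _ ?_, ?_⟩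
      · rw [norm_smul, Real.norm_of_nonneg (by positivity), div_mul_cancel₀ _ hx'.ne']
      · rw [id, real_inner_smul_right, real_inner_self_eq_norm_sq]
        exact le_of_eq (by field_simp)

theorem IsConvC.exists_conj_le {ψ : E n → EReal} (hψ : IsConvC ψ) :
    ∃ δ > 0, ∃ M : ℝ, ∀ y, ‖y‖ ≤ δ → conj ψ y ≤ (M : EReal) := by
  obtain ⟨δ, hδ, M, hM⟩ := hψ.exists_linear_growth
  refine ⟨δ, hδ, M, fun y hy => (conj_le_coe_iff ψ y M).2 fun x => le_trans ?_ (hM x)⟩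
  have := (real_inner_le_norm y x).trans (mul_le_mul_of_nonneg_right hy (norm_nonneg x))
  norm_cast
  linarith

/-! ### Outer linearizations as suprema of affine functions -/

theorem maxIntercept_eq {ψ : E n → EReal} (y : E n) : maxIntercept ψ y = -conj ψ y := by
  have key : ∀ c : ℝ, (∀ x : E n, ((inner ℝ x y + c : ℝ) : EReal) ≤ ψ x) ↔
      (c : EReal) ≤ -conj ψ y := by
    intro c
    rw [EReal.le_neg, ← EReal.coe_neg, conj_le_coe_iff]
    simp only [sub_neg_eq_add, real_inner_comm]
  simp only [maxIntercept, mem_ofPred_eq, key]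
  refine le_antisymm (iSup₂_le fun c hc => hc) ?_
  refine EReal.ge_of_forall_gt_iff_ge.1 fun z hz => ?_
  exact le_iSup₂ (f := fun (c : ℝ) (_ : (c : EReal) ≤ -conj ψ y) => (c : EReal)) z hz.le

theorem outerLin_eq_affineSup (ψ : E n → EReal) (Y : Set (E n)) :
    outerLin ψ Y = affineSup (fun y : Y => (y : E n)) (fun y : Y => conj ψ y) := by
  funext x
  simp only [outerLin, affMinorant, maxIntercept_eq, affineSup, iSup_subtype', sub_eq_add_neg]

theorem outerLin_le {ψ : E n → EReal} (Y : Set (E n)) (x : E n) : outerLin ψ Y x ≤ ψ x := by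
  rw [outerLin_eq_affineSup]
  refine iSup_le fun y => ?_
  refine EReal.le_of_forall_lt_iff_le.1 fun r hr => ?_
  rw [coe_sub_le_coe_iff, ← EReal.ge_of_forall_gt_iff_ge]
  intro s hs
  by_contra! hcon
  obtain ⟨t, ht1, ht2⟩ := EReal.lt_iff_exists_real_btwn.1 hcon
  have := coe_le_of_conj_le_coe ht1.le hr.le
  rw [real_inner_comm] at this
  norm_cast at hs ht2
  linarith

/-! ### The Fenchel--Moreau theorem -/

theorem le_of_forall_epigraph {φ : E n → EReal} {y : E n} {c : ℝ}
    (h : ∀ t : ℝ, φ y ≤ (t : EReal) → c ≤ t) : (c : EReal) ≤ φ y :=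
  EReal.le_of_forall_lt_iff_le.1 fun t ht => by exact_mod_cast h t ht.le

theorem isClosed_epigraph {φ : E n → EReal} (hlsc : LowerSemicontinuous φ) :
    IsClosed {p : E n × ℝ | φ p.1 ≤ (p.2 : EReal)} :=
  hlsc.isClosed_epigraph.preimage
    (continuous_fst.prodMk (continuous_coe_real_ereal.comp continuous_snd))

/-- A point strictly below the graph is strictly separated from the epigraph. -/
theorem exists_separation {φ : E n → EReal}
    (hconv : Convex ℝ {p : E n × ℝ | φ p.1 ≤ (p.2 : EReal)}) (hlsc : LowerSemicontinuous φ)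
    {x₀ : E n} {t₀ : ℝ} (h : (t₀ : EReal) < φ x₀) :
    ∃ (v : E n) (α u : ℝ), inner ℝ v x₀ + t₀ * α < u ∧
      ∀ y (t : ℝ), φ y ≤ (t : EReal) → u < inner ℝ v y + t * α := by
  obtain ⟨f, u, hu, hb⟩ := geometric_hahn_banach_point_closed (x := (x₀, t₀)) hconv
    (isClosed_epigraph hlsc) (by simpa using h)
  have hf : ∀ (y : E n) (t : ℝ), f (y, t) =
      inner ℝ ((InnerProductSpace.toDual ℝ (E n)).symm
        (f.comp (ContinuousLinearMap.inl ℝ (E n) ℝ))) y + t * f (0, 1) := by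
    intro y t
    rw [InnerProductSpace.toDual_symm_apply]
    have h1 : ((y, t) : E n × ℝ) = (y, 0) + t • ((0 : E n), (1 : ℝ)) := by simp
    rw [h1, map_add, map_smul, smul_eq_mul]
    simp
  refine ⟨_, f (0, 1), u, by rw [← hf]; exact hu, fun y t ht => ?_⟩
  rw [← hf]
  exact hb (y, t) ht

/-- A non-vertical separating hyperplane is the graph of an affine function, found by solving for
the last coordinate. -/
theorem exists_affine_minorant_of_pos {φ : E n → EReal} {x₀ v : E n} {t₀ α u : ℝ} (hα : 0 < α)
    (h₀ : inner ℝ v x₀ + t₀ * α < u)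
    (h : ∀ y (t : ℝ), φ y ≤ (t : EReal) → u < inner ℝ v y + t * α) :
    ∃ (a : E n) (b : ℝ), (∀ y, ((inner ℝ a y - b : ℝ) : EReal) ≤ φ y) ∧
      t₀ < inner ℝ a x₀ - b := by
  have hval : ∀ y, inner ℝ (-(α⁻¹ • v)) y - -(α⁻¹ * u) = (u - inner ℝ v y) / α := by
    intro y
    rw [inner_neg_left, real_inner_smul_left]
    field_simp
    ring
  refine ⟨-(α⁻¹ • v), -(α⁻¹ * u), fun y => le_of_forall_epigraph fun t ht => ?_, ?_⟩
  · rw [hval, div_le_iff₀ hα]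
    linarith [h y t ht]
  · rw [hval, lt_div_iff₀ hα]
    linarith

theorem exists_affine_minorant {φ : E n → EReal} (hbot : ∀ x, φ x ≠ ⊥)
    (hconv : Convex ℝ {p : E n × ℝ | φ p.1 ≤ (p.2 : EReal)}) (hlsc : LowerSemicontinuous φ)
    (hproper : ∃ x, φ x ≠ ⊤) {x₀ : E n} {t₀ : ℝ} (h : (t₀ : EReal) < φ x₀) :
    ∃ (a : E n) (b : ℝ), (∀ y, ((inner ℝ a y - b : ℝ) : EReal) ≤ φ y) ∧
      t₀ < inner ℝ a x₀ - b := by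
  obtain ⟨x₁, hx₁⟩ := hproper
  lift φ x₁ to ℝ using ⟨hx₁, hbot x₁⟩ with r₁ hr₁
  -- Below a point of the domain the hyperplane cannot be vertical, so at least one affine minorant
  -- exists.
  obtain ⟨a₁, b₁, hmin, -⟩ : ∃ (a : E n) (b : ℝ), (∀ y, ((inner ℝ a y - b : ℝ) : EReal) ≤ φ y) ∧
      r₁ - 1 < inner ℝ a x₁ - b := by
    obtain ⟨v, α, u, hu, hsep⟩ := exists_separation hconv hlsc (x₀ := x₁) (t₀ := r₁ - 1)
      (by rw [← hr₁]; norm_cast; linarith)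
    refine exists_affine_minorant_of_pos ?_ hu hsep
    have := hsep x₁ r₁ hr₁.ge
    nlinarith
  obtain ⟨v, α, u, hu, hsep⟩ := exists_separation hconv hlsc h
  rcases lt_trichotomy α 0 with hα | rfl | hα
  · exfalso
    -- A negative `α` is impossible: the epigraph contains the upward ray over `x₁`, and height `s`
    -- already violates the separation.
    set s := max r₁ ((inner ℝ v x₁ - u) / -α) with hs
    have h1 := hsep x₁ s (by rw [← hr₁]; exact_mod_cast le_max_left _ _)
    have h2 : (inner ℝ v x₁ - u) / -α ≤ s := le_max_right _ _
    rw [div_le_iff₀ (by linarith)] at h2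
    linarith
  -- For a vertical hyperplane, `u - ⟨v, ·⟩` is nonpositive on the domain and positive at `x₀`.
  -- Adding a large multiple of it to the minorant found above keeps a minorant and lifts it past
  -- `t₀` at `x₀`.
  · simp only [mul_zero, add_zero] at hu hsep
    have hgap : 0 < u - inner ℝ v x₀ := by linarith
    obtain ⟨k, hk⟩ := exists_nat_gt ((t₀ - (inner ℝ a₁ x₀ - b₁)) / (u - inner ℝ v x₀))
    rw [div_lt_iff₀ hgap] at hk
    have hval : ∀ y, inner ℝ (a₁ - (k : ℝ) • v) y - (b₁ - k * u) =
        inner ℝ a₁ y - b₁ + k * (u - inner ℝ v y) := by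
      intro y
      rw [inner_sub_left, real_inner_smul_left]
      ring
    refine ⟨a₁ - (k : ℝ) • v, b₁ - k * u, fun y => le_of_forall_epigraph fun t ht => ?_, ?_⟩
    · have h1 : inner ℝ a₁ y - b₁ ≤ t := by exact_mod_cast (hmin y).trans ht
      have h2 := hsep y t ht
      have h3 : (k : ℝ) * (u - inner ℝ v y) ≤ 0 :=
        mul_nonpos_of_nonneg_of_nonpos (Nat.cast_nonneg k) (by linarith)
      rw [hval]
      linarith
    · rw [hval]
      linarith
  · exact exists_affine_minorant_of_pos hα hu hsep

/-- The Fenchel--Moreau theorem. -/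
theorem conj_conj {φ : E n → EReal} (hbot : ∀ x, φ x ≠ ⊥)
    (hconv : Convex ℝ {p : E n × ℝ | φ p.1 ≤ (p.2 : EReal)}) (hlsc : LowerSemicontinuous φ)
    (hproper : ∃ x, φ x ≠ ⊤) : conj (conj φ) = φ := by
  funext x
  refine le_antisymm ?_ ?_
  · refine EReal.le_of_forall_lt_iff_le.1 fun r hr => ?_
    rw [conj_le_coe_iff]
    refine fun y => le_of_forall_epigraph fun t ht => ?_
    have := coe_le_of_conj_le_coe ht hr.le
    rw [real_inner_comm] at this
    linarith
  · refine EReal.ge_of_forall_gt_iff_ge.1 fun t ht => ?_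
    obtain ⟨a, b, hmin, hlt⟩ := exists_affine_minorant hbot hconv hlsc hproper ht
    have hab : conj φ a ≤ (b : EReal) := (conj_le_coe_iff φ a b).2 hmin
    refine EReal.le_of_forall_lt_iff_le.1 fun r hr => ?_
    have := coe_le_of_conj_le_coe hr.le hab
    rw [real_inner_comm] at this
    norm_cast
    linarith

/-! ### Infimal convolutions and epi-multiples -/

theorem infConv_lt_coe_iff (ψ₁ ψ₂ : E n → EReal) (x : E n) (r : ℝ) :
    infConv ψ₁ ψ₂ x < (r : EReal) ↔ ∃ y, ψ₁ (x - y) + ψ₂ y < (r : EReal) := by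
  rw [infConv, iInf_lt_iff]

theorem exists_coe_of_add_lt {a b : EReal} (ha : a ≠ ⊥) (hb : b ≠ ⊥) {r : ℝ}
    (h : a + b < (r : EReal)) : ∃ s t : ℝ, a = s ∧ b = t ∧ s + t < r := by
  induction a with
  | bot => exact absurd rfl ha
  | top => rw [EReal.top_add_of_ne_bot hb] at h; exact absurd h not_top_lt
  | coe s =>
    induction b with
    | bot => exact absurd rfl hb
    | top => simp at h
    | coe t => exact ⟨s, t, rfl, rfl, by exact_mod_cast h⟩

/-- Each summand is bounded below, hence the other is bounded above on this set, which therefore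
sits in a product of two compact sublevel sets. -/
theorem isCompact_prod_add_le {ψ₁ ψ₂ : E n → EReal} (h₁ : IsConvC ψ₁) (h₂ : IsConvC ψ₂) (t : ℝ) :
    IsCompact {p : E n × E n | ψ₁ p.1 + ψ₂ p.2 ≤ (t : EReal)} := by
  obtain ⟨m₁, hm₁⟩ := h₁.exists_lower_bound
  obtain ⟨m₂, hm₂⟩ := h₂.exists_lower_bound
  refine ((h₁.isCompact_le (t - m₂)).prod (h₂.isCompact_le (t - m₁))).of_isClosed_subset ?_ ?_
  · refine LowerSemicontinuous.isClosed_preimage (f := fun p : E n × E n => ψ₁ p.1 + ψ₂ p.2) ?_ _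
    refine (h₁.lsc.comp continuous_fst).add' (h₂.lsc.comp continuous_snd) fun p => ?_
    exact EReal.continuousAt_add (Or.inr (h₂.ne_bot _)) (Or.inl (h₁.ne_bot _))
  · rintro ⟨u, v⟩ huv
    simp only [mem_ofPred_eq] at huv
    constructor
    · have h := (add_le_add le_rfl (hm₂ v)).trans huv
      have h' := EReal.sub_le_sub h (le_refl (m₂ : EReal))
      rwa [EReal.add_sub_cancel_right, ← EReal.coe_sub] at h'
    · have h := (add_le_add (hm₁ u) le_rfl).trans huv
      have h' := EReal.sub_le_sub h (le_refl (m₁ : EReal))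
      rwa [EReal.add_sub_cancel_left, ← EReal.coe_sub] at h'

theorem IsConvC.infConv {ψ₁ ψ₂ : E n → EReal} (h₁ : IsConvC ψ₁) (h₂ : IsConvC ψ₂) :
    IsConvC (infConv ψ₁ ψ₂) := by
  obtain ⟨m₁, hm₁⟩ := h₁.exists_lower_bound
  obtain ⟨m₂, hm₂⟩ := h₂.exists_lower_bound
  refine IsConvC.of_isCompact (fun x hx => ?_) ?_ ?_ fun t => ?_
  · have : ((m₁ + m₂ : ℝ) : EReal) ≤ OuterLin.infConv ψ₁ ψ₂ x :=
      le_iInf fun y => by rw [EReal.coe_add]; exact add_le_add (hm₁ _) (hm₂ _)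
    rw [hx, le_bot_iff] at this
    exact EReal.coe_ne_bot _ this
  · rintro ⟨x, r⟩ hx ⟨x', r'⟩ hx' a b ha hb hab
    simp only [mem_ofPred_eq, Prod.smul_mk, Prod.mk_add_mk] at hx hx' ⊢
    refine EReal.le_of_forall_lt_iff_le.1 fun q hq => ?_
    simp only [smul_eq_mul] at hq
    norm_cast at hq
    -- Near-minimizers with error `ε` are enough: the weighted errors `aε + bε` add up to exactly
    -- the available slack.
    set ε := q - (a * r + b * r') with hε
    have hεpos : 0 < ε := by linarith
    obtain ⟨y, hy⟩ := (infConv_lt_coe_iff ψ₁ ψ₂ x (r + ε)).1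
      (hx.trans_lt (by norm_cast; linarith))
    obtain ⟨y', hy'⟩ := (infConv_lt_coe_iff ψ₁ ψ₂ x' (r' + ε)).1
      (hx'.trans_lt (by norm_cast; linarith))
    obtain ⟨s, t, hs, ht, hst⟩ := exists_coe_of_add_lt (h₁.ne_bot _) (h₂.ne_bot _) hy
    obtain ⟨s', t', hs', ht', hst'⟩ := exists_coe_of_add_lt (h₁.ne_bot _) (h₂.ne_bot _) hy'
    refine (iInf_le _ (a • y + b • y')).trans ?_
    have e : a • x + b • x' - (a • y + b • y') = a • (x - y) + b • (x' - y') := by module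
    rw [e]
    refine (add_le_add (coe_combo_le h₁.convex hs.le hs'.le ha hb hab)
      (coe_combo_le h₂.convex ht.le ht'.le ha hb hab)).trans ?_
    norm_cast
    have e1 := mul_le_mul_of_nonneg_left hst.le ha
    have e2 := mul_le_mul_of_nonneg_left hst'.le hb
    have e3 : a * ε + b * ε = ε := by rw [← add_mul, hab, one_mul]
    linarith
  · obtain ⟨u, r, hr⟩ := h₁.exists_coe
    obtain ⟨v, s, hs⟩ := h₂.exists_coe
    refine ⟨u + v, ne_top_of_le_ne_top (EReal.coe_ne_top (r + s)) ((iInf_le _ v).trans ?_)⟩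
    rw [add_sub_cancel_right, hr, hs, EReal.coe_add]
  -- Intersecting over all levels `s > t` avoids showing that the infimum is attained; each set in
  -- the intersection is a continuous image of a compact set.
  · have heq : {x | OuterLin.infConv ψ₁ ψ₂ x ≤ (t : EReal)} = ⋂ s : Ioi t,
        (fun p : E n × E n => p.1 + p.2) '' {p | ψ₁ p.1 + ψ₂ p.2 ≤ ((s : ℝ) : EReal)} := by
      ext x
      simp only [mem_ofPred_eq, mem_iInter]
      constructor
      · rintro hx ⟨s, hs⟩
        obtain ⟨y, hy⟩ := (infConv_lt_coe_iff ψ₁ ψ₂ x s).1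
          (hx.trans_lt (by exact_mod_cast hs))
        exact ⟨(x - y, y), hy.le, by simp⟩
      · intro hx
        refine EReal.le_of_forall_lt_iff_le.1 fun s hs => ?_
        obtain ⟨⟨u, v⟩, huv, rfl⟩ := hx ⟨s, by exact_mod_cast hs⟩
        refine (iInf_le _ v).trans ?_
        simpa using huv
    have hc : ∀ s : ℝ, IsCompact ((fun p : E n × E n => p.1 + p.2) ''
        {p | ψ₁ p.1 + ψ₂ p.2 ≤ ((s : ℝ) : EReal)}) := fun s =>
      (isCompact_prod_add_le h₁ h₂ s).image continuous_add
    rw [heq]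
    exact (hc (t + 1)).of_isClosed_subset (isClosed_iInter fun s => (hc s).isClosed)
      (iInter_subset _ (⟨t + 1, by simp⟩ : Ioi t))

theorem coe_mul_le_coe_iff {c : ℝ} (hc : 0 < c) (v : EReal) (t : ℝ) :
    (c : EReal) * v ≤ (t : EReal) ↔ v ≤ ((c⁻¹ * t : ℝ) : EReal) := by
  induction v with
  | bot => simp [EReal.coe_mul_bot_of_pos hc]
  | top =>
    rw [EReal.coe_mul_top_of_pos hc, top_le_iff, top_le_iff]
    exact iff_of_false (EReal.coe_ne_top _) (EReal.coe_ne_top _)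
  | coe v => norm_cast; rw [le_inv_mul_iff₀ hc]

theorem coe_mul_ne_top_iff {c : ℝ} (hc : 0 < c) (v : EReal) : (c : EReal) * v ≠ ⊤ ↔ v ≠ ⊤ := by
  induction v with
  | bot => simp [EReal.coe_mul_bot_of_pos hc]
  | top => simp [EReal.coe_mul_top_of_pos hc]
  | coe v => rw [← EReal.coe_mul]; exact iff_of_true (EReal.coe_ne_top _) (EReal.coe_ne_top _)

theorem coe_mul_ne_bot_iff {c : ℝ} (hc : 0 < c) (v : EReal) : (c : EReal) * v ≠ ⊥ ↔ v ≠ ⊥ := by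
  induction v with
  | bot => simp [EReal.coe_mul_bot_of_pos hc]
  | top => simp [EReal.coe_mul_top_of_pos hc]
  | coe v => rw [← EReal.coe_mul]; exact iff_of_true (EReal.coe_ne_bot _) (EReal.coe_ne_bot _)

theorem IsConvC.epiMul {ψ : E n → EReal} (hψ : IsConvC ψ) {c : ℝ} (hc : 0 < c) :
    IsConvC (epiMul c ψ) := by
  refine IsConvC.of_isCompact (fun x => (coe_mul_ne_bot_iff hc _).2 (hψ.ne_bot _)) ?_ ?_ fun t => ?_
  · simp only [OuterLin.epiMul, coe_mul_le_coe_iff hc]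
    exact hψ.convex.linear_preimage
      ((c⁻¹ • LinearMap.id : E n →ₗ[ℝ] E n).prodMap (c⁻¹ • LinearMap.id : ℝ →ₗ[ℝ] ℝ))
  · obtain ⟨x, hx⟩ := hψ.proper
    refine ⟨c • x, (coe_mul_ne_top_iff hc _).2 ?_⟩
    rwa [inv_smul_smul₀ hc.ne']
  · simp only [OuterLin.epiMul, coe_mul_le_coe_iff hc]
    convert (hψ.isCompact_le (c⁻¹ * t)).image (continuous_const_smul c) using 1
    ext x
    simp only [mem_ofPred_eq, mem_image]
    constructor
    · exact fun hx => ⟨c⁻¹ • x, hx, smul_inv_smul₀ hc.ne' x⟩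
    · rintro ⟨y, hy, rfl⟩
      rwa [inv_smul_smul₀ hc.ne']

theorem homothety_expNeg (c : ℝ) (ψ : E n → EReal) :
    homothety c (expNeg ψ) = expNeg (epiMul c ψ) := by
  funext x
  rw [homothety, expNeg, expNeg, epiMul, ← EReal.exp_mul, EReal.neg_mul, mul_comm]

/-- `v ↦ e^{-v}` is an order-reversing bijection, so it turns the infimum into a supremum. The
factors swap because the two definitions put `x - y` in different slots. -/
theorem asplund_expNeg {ψ₁ ψ₂ : E n → EReal} (h₁ : ∀ x, ψ₁ x ≠ ⊥) (h₂ : ∀ x, ψ₂ x ≠ ⊥) :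
    asplund (expNeg ψ₁) (expNeg ψ₂) = expNeg (infConv ψ₂ ψ₁) := by
  funext x
  have : expNeg (infConv ψ₂ ψ₁) x =
      (EReal.negOrderIso.trans EReal.expOrderIso.dual) (infConv ψ₂ ψ₁ x) := rfl
  rw [this, infConv, OrderIso.map_iInf]
  change _ = ⨆ y, EReal.exp (-(ψ₂ (x - y) + ψ₁ y))
  refine iSup_congr fun y => ?_
  rw [EReal.neg_add (Or.inl (h₂ _)) (Or.inr (h₁ _)),
    sub_eq_add_neg (-ψ₂ (x - y)), EReal.exp_add, mul_comm]
  rfl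

/-! ### Rotations -/

theorem toEuclideanLin_inv_mul (ϑ ρ : Matrix (Fin n) (Fin n) ℝ) (x : E n) :
    Matrix.toEuclideanLin (ϑ * ρ)⁻¹ x =
      Matrix.toEuclideanLin ρ⁻¹ (Matrix.toEuclideanLin ϑ⁻¹ x) := by
  rw [Matrix.mul_inv_rev, Matrix.toLpLin_mul 2 2 2]
  rfl

theorem inv_eq_transpose {ϑ : Matrix (Fin n) (Fin n) ℝ}
    (hϑ : ϑ ∈ Matrix.orthogonalGroup (Fin n) ℝ) : ϑ⁻¹ = ϑ.transpose :=
  Matrix.inv_eq_left_inv ((Matrix.mem_orthogonalGroup_iff' _ _).1 hϑ)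

theorem toEuclideanLin_inv_apply_self {ϑ : Matrix (Fin n) (Fin n) ℝ}
    (hϑ : ϑ ∈ Matrix.orthogonalGroup (Fin n) ℝ) (x : E n) :
    Matrix.toEuclideanLin ϑ⁻¹ (Matrix.toEuclideanLin ϑ x) = x := by
  have h : Matrix.toEuclideanLin (ϑ⁻¹ * ϑ) x =
      Matrix.toEuclideanLin ϑ⁻¹ (Matrix.toEuclideanLin ϑ x) := by
    rw [Matrix.toLpLin_mul 2 2 2]
    rfl
  rw [← h, inv_eq_transpose hϑ, (Matrix.mem_orthogonalGroup_iff' _ _).1 hϑ, Matrix.toLpLin_one]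
  rfl

theorem inner_toEuclideanLin_inv {ϑ : Matrix (Fin n) (Fin n) ℝ}
    (hϑ : ϑ ∈ Matrix.orthogonalGroup (Fin n) ℝ) (x y : E n) :
    inner ℝ (Matrix.toEuclideanLin ϑ⁻¹ x) (Matrix.toEuclideanLin ϑ⁻¹ y) = inner ℝ x y := by
  have h1 : Matrix.toEuclideanLin ϑ⁻¹ = LinearMap.adjoint (Matrix.toEuclideanLin ϑ) := by
    rw [inv_eq_transpose hϑ, ← Matrix.toEuclideanLin_conjTranspose_eq_adjoint,
      Matrix.conjTranspose_eq_transpose_of_trivial]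
  have h2 : Matrix.toEuclideanLin ϑ (Matrix.toEuclideanLin ϑ⁻¹ x) = x := by
    have h : Matrix.toEuclideanLin (ϑ * ϑ⁻¹) x =
        Matrix.toEuclideanLin ϑ (Matrix.toEuclideanLin ϑ⁻¹ x) := by
      rw [Matrix.toLpLin_mul 2 2 2]
      rfl
    rw [← h, inv_eq_transpose hϑ, (Matrix.mem_orthogonalGroup_iff _ _).1 hϑ, Matrix.toLpLin_one]
    rfl
  nth_rewrite 2 [h1]
  rw [LinearMap.adjoint_inner_right, h2]

theorem norm_toEuclideanLin_inv {ϑ : Matrix (Fin n) (Fin n) ℝ}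
    (hϑ : ϑ ∈ Matrix.orthogonalGroup (Fin n) ℝ) (x : E n) :
    ‖Matrix.toEuclideanLin ϑ⁻¹ x‖ = ‖x‖ := by
  rw [norm_eq_sqrt_real_inner, inner_toEuclideanLin_inv hϑ, ← norm_eq_sqrt_real_inner]

theorem conj_rotate {ϑ : Matrix (Fin n) (Fin n) ℝ}
    (hϑ : ϑ ∈ Matrix.orthogonalGroup (Fin n) ℝ) (ψ : E n → EReal) (y : E n) :
    conj (rotate ϑ ψ) y = conj ψ (Matrix.toEuclideanLin ϑ⁻¹ y) := by
  refine eq_of_forall_le_coe_iff fun r => ?_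
  rw [conj_le_coe_iff, conj_le_coe_iff]
  constructor
  · intro h w
    have := h (Matrix.toEuclideanLin ϑ w)
    rwa [rotate, toEuclideanLin_inv_apply_self hϑ, ← inner_toEuclideanLin_inv hϑ,
      toEuclideanLin_inv_apply_self hϑ] at this
  · intro h x
    rw [← inner_toEuclideanLin_inv hϑ]
    exact h _

theorem exists_rotate_ne_top {ϑ : Matrix (Fin n) (Fin n) ℝ}
    (hϑ : ϑ ∈ Matrix.orthogonalGroup (Fin n) ℝ) {ψ : E n → EReal} (hψ : ∃ x, ψ x ≠ ⊤) :
    ∃ x, rotate ϑ ψ x ≠ ⊤ := by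
  obtain ⟨x, hx⟩ := hψ
  exact ⟨Matrix.toEuclideanLin ϑ x, by rwa [rotate, toEuclideanLin_inv_apply_self hϑ]⟩

theorem motions_subset : motions n ⊆ Matrix.orthogonalGroup (Fin n) ℝ := by
  intro ϑ hϑ
  unfold motions at hϑ
  split_ifs at hϑ
  · exact hϑ
  · exact (Matrix.mem_specialOrthogonalGroup_iff.1 hϑ).1

theorem mul_mem_motions {ϑ ρ : Matrix (Fin n) (Fin n) ℝ} (hϑ : ϑ ∈ motions n)
    (hρ : ρ ∈ motions n) : ϑ * ρ ∈ motions n := by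
  unfold motions at *
  split_ifs at * with h
  · exact mul_mem hϑ hρ
  · exact mul_mem hϑ hρ

/-! ### Positively spanning sets -/

/-- Otherwise `Y`, hence its hull, lies in the half-space `⟨x, ·⟩ ≤ 0`; but the hull contains `x`.
-/
theorem exists_inner_pos_of_hull_eq_top {Y : Set (E n)} (hY : PointedCone.hull ℝ Y = ⊤) {x : E n}
    (hx : x ≠ 0) : ∃ y ∈ Y, 0 < inner ℝ x y := by
  by_contra! h
  have hmem : x ∈ PointedCone.hull ℝ Y := hY ▸ Submodule.mem_top
  have : inner ℝ x x ≤ 0 := by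
    refine Submodule.span_induction (p := fun w _ => inner ℝ x w ≤ 0) h (by simp) ?_ ?_ hmem
    · intro a b _ _ ha hb
      rw [inner_add_right]
      exact add_nonpos ha hb
    · rintro ⟨a, ha⟩ b _ hb
      change inner ℝ x (a • b) ≤ 0
      rw [real_inner_smul_right]
      exact mul_nonpos_of_nonneg_of_nonpos ha hb
  rw [real_inner_self_eq_norm_sq] at this
  exact absurd this (not_le.2 (by positivity))

/-- Compactness of the unit sphere: a slope with `⟨x, y⟩ > 0` still gives half that value near `x`,
and finitely many such neighbourhoods cover. -/
theorem exists_finite_positively_spanning (hn : 1 ≤ n) {Y : Set (E n)}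
    (hY : PointedCone.hull ℝ Y = ⊤) :
    ∃ Z ⊆ Y, Z.Finite ∧ ∃ δ > 0, ∀ x, ∃ z ∈ Z, δ * ‖x‖ ≤ inner ℝ x z := by
  obtain ⟨Z, hZY, hZ, δ, hδ, h⟩ : ∃ Z ⊆ Y, Z.Finite ∧ ∃ δ > 0,
      ∀ x ∈ Metric.sphere (0 : E n) 1, ∃ z ∈ Z, δ ≤ inner ℝ x z := by
    refine (isCompact_sphere (0 : E n) 1).induction_on (p := fun S => ∃ Z ⊆ Y, Z.Finite ∧ ∃ δ > 0,
      ∀ x ∈ S, ∃ z ∈ Z, δ ≤ inner ℝ x z) ?_ ?_ ?_ ?_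
    · exact ⟨∅, empty_subset _, finite_empty, 1, one_pos, by simp⟩
    · rintro S T hST ⟨Z, hZY, hZ, δ, hδ, h⟩
      exact ⟨Z, hZY, hZ, δ, hδ, fun x hx => h x (hST hx)⟩
    · rintro S T ⟨Z, hZY, hZ, δ, hδ, h⟩ ⟨Z', hZY', hZ', δ', hδ', h'⟩
      refine ⟨Z ∪ Z', union_subset hZY hZY', hZ.union hZ', min δ δ', lt_min hδ hδ', ?_⟩
      rintro x (hx | hx)
      · obtain ⟨z, hz, hxz⟩ := h x hx
        exact ⟨z, Or.inl hz, (min_le_left _ _).trans hxz⟩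
      · obtain ⟨z, hz, hxz⟩ := h' x hx
        exact ⟨z, Or.inr hz, (min_le_right _ _).trans hxz⟩
    · intro x hx
      obtain ⟨y, hy, hxy⟩ := exists_inner_pos_of_hull_eq_top hY
        (Metric.ne_of_mem_sphere hx one_ne_zero)
      refine ⟨{w | inner ℝ x y / 2 < inner ℝ w y}, mem_nhdsWithin_of_mem_nhds ?_, {y},
        singleton_subset_iff.2 hy, finite_singleton y, inner ℝ x y / 2, half_pos hxy,
        fun w hw => ⟨y, rfl, le_of_lt hw⟩⟩
      exact (isOpen_lt continuous_const (by fun_prop)).mem_nhds (half_lt_self hxy)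
  have : Nonempty (Fin n) := ⟨⟨0, hn⟩⟩
  refine ⟨Z, hZY, hZ, δ, hδ, fun x => ?_⟩
  rcases eq_or_ne x 0 with rfl | hx
  -- At the origin only `Z ≠ ∅` is needed; a unit vector, available since `n ≥ 1`, supplies an
  -- element.
  · obtain ⟨e, he⟩ := exists_norm_eq (E n) zero_le_one
    obtain ⟨z, hz, -⟩ := h e (by simpa using he)
    exact ⟨z, hz, by simp⟩
  · have hx' : 0 < ‖x‖ := norm_pos_iff.2 hx
    obtain ⟨z, hz, hxz⟩ := h (‖x‖⁻¹ • x) (by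
      rw [mem_sphere_zero_iff_norm, norm_smul, norm_inv, norm_norm, inv_mul_cancel₀ hx'.ne'])
    refine ⟨z, hz, ?_⟩
    rw [real_inner_smul_left, le_inv_mul_iff₀ hx'] at hxz
    linarith

/-- An outer linearization is in `Conv_c` if its slopes at which the conjugate is finite positively
span `ℝⁿ`. -/
theorem isConvC_outerLin (hn : 1 ≤ n) {ψ : E n → EReal} (hψ : ∃ x, ψ x ≠ ⊤) {Y Y₀ : Set (E n)}
    (hsub : Y₀ ⊆ Y) (hhull : PointedCone.hull ℝ Y₀ = ⊤) (hfin : ∀ y ∈ Y₀, conj ψ y < ⊤) :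
    IsConvC (outerLin ψ Y) := by
  obtain ⟨Z, hZY, hZ, δ, hδ, hgrow⟩ := exists_finite_positively_spanning hn hhull
  obtain ⟨M, hM⟩ := (hZ.image fun z => (conj ψ z).toReal).bddAbove
  rw [outerLin_eq_affineSup]
  refine isConvC_affineSup _ _ ?_ hδ (M := M) fun x => ?_
  · obtain ⟨x, hx⟩ := hψ
    refine ⟨x, ne_top_of_le_ne_top hx ?_⟩
    rw [← outerLin_eq_affineSup]
    exact outerLin_le Y x
  · obtain ⟨z, hz, hxz⟩ := hgrow x
    refine ⟨⟨z, hsub (hZY hz)⟩, ?_, hxz⟩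
    exact (EReal.le_coe_toReal (hfin z (hZY hz)).ne).trans
      (by exact_mod_cast hM (mem_image_of_mem _ hz))

/-! ### Inner radii -/

theorem exists_ball_of_mem_openInnerBall {ψ : E n → EReal} {x : E n}
    (hx : x ∈ openInnerBall ψ) :
    ∃ r : ℝ≥0, Metric.closedBall (0 : E n) r ⊆ dom (conj ψ) ∧ ‖x‖ < r := by
  simp only [openInnerBall, innerRadius, mem_ofPred_eq, lt_iSup_iff] at hx
  obtain ⟨r, hr, hxr⟩ := hx
  refine ⟨r, hr, ?_⟩
  rw [enorm_eq_nnnorm] at hxr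
  exact_mod_cast hxr

theorem lt_top_of_mem_openInnerBall {ψ : E n → EReal} {x y : E n} (hx : x ∈ openInnerBall ψ)
    (hy : ‖y‖ ≤ ‖x‖) : conj ψ y < ⊤ := by
  obtain ⟨r, hr, hxr⟩ := exists_ball_of_mem_openInnerBall hx
  exact hr (mem_closedBall_zero_iff.2 (hy.trans hxr.le))

theorem mem_openInnerBall_of_ball {ψ : E n → EReal} {x : E n} {r : ℝ} (hx : ‖x‖ < r)
    (hr : Metric.closedBall (0 : E n) r ⊆ dom (conj ψ)) : x ∈ openInnerBall ψ := by
  simp only [openInnerBall, innerRadius, mem_ofPred_eq, lt_iSup_iff]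
  have hr0 : 0 ≤ r := (norm_nonneg x).trans hx.le
  refine ⟨⟨r, hr0⟩, hr, ?_⟩
  rw [enorm_eq_nnnorm]
  exact ENNReal.coe_lt_coe.2 (show ‖x‖₊ < ⟨r, hr0⟩ from hx)

/-- The ball of radius `r(ψ)` is invariant under orthogonal maps, so one `Y₀` serves all `ϑ`. -/
theorem isConvC_outerLin_rotate (hn : 1 ≤ n) {ψ : E n → EReal} (hψ : IsConvC ψ) {Y : Set (E n)}
    (hY : Y ∈ admissible ψ) {ϑ : Matrix (Fin n) (Fin n) ℝ}
    (hϑ : ϑ ∈ Matrix.orthogonalGroup (Fin n) ℝ) : IsConvC (outerLin (rotate ϑ ψ) Y) := by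
  obtain ⟨Y₀, hsub, hhull, hball⟩ := hY
  refine isConvC_outerLin hn (exists_rotate_ne_top hϑ hψ.proper) hsub hhull fun y hy => ?_
  rw [conj_rotate hϑ]
  exact lt_top_of_mem_openInnerBall (hball hy) (norm_toEuclideanLin_inv hϑ y).le

/-- A convex function that is finite on a closed ball is bounded above on smaller balls. -/
theorem exists_le_on_smaller_ball {φ : E n → EReal} (hbot : ∀ x, φ x ≠ ⊥)
    (hconv : Convex ℝ {p : E n × ℝ | φ p.1 ≤ (p.2 : EReal)}) {r s : ℝ} (hsr : s < r)
    (hr : Metric.closedBall (0 : E n) r ⊆ dom φ) :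
    ∃ M : ℝ, ∀ y, ‖y‖ ≤ s → φ y ≤ (M : EReal) := by
  have hfin : ∀ x ∈ Metric.ball (0 : E n) r, φ x = ((φ x).toReal : EReal) := fun x hx =>
    (EReal.coe_toReal (hr (Metric.ball_subset_closedBall hx)).ne (hbot x)).symm
  have hc : ConvexOn ℝ (Metric.ball (0 : E n) r) fun x => (φ x).toReal := by
    refine ⟨convex_ball 0 r, fun x hx y hy a b ha hb hab => ?_⟩
    have h := coe_combo_le hconv (hfin x hx).le (hfin y hy).le ha hb hab
    rw [hfin _ (convex_ball (0 : E n) r hx hy ha hb hab)] at h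
    exact_mod_cast h
  -- A finite convex function on an open ball of `ℝⁿ` is continuous, hence bounded on smaller closed
  -- balls.
  have hcont := (hc.continuousOn Metric.isOpen_ball).mono
    (Metric.closedBall_subset_ball (x := (0 : E n)) hsr)
  obtain ⟨M, hM⟩ := (isCompact_closedBall (0 : E n) s).bddAbove_image hcont
  refine ⟨M, fun y hy => ?_⟩
  have hy' : y ∈ Metric.closedBall (0 : E n) s := mem_closedBall_zero_iff.2 hy
  rw [hfin y (Metric.closedBall_subset_ball hsr hy')]
  exact_mod_cast hM (mem_image_of_mem _ hy')

/-! ### Integrals of extended real functions bounded below -/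

section ExtIntegral
variable {Ω : Type*} [MeasurableSpace Ω] {μ : Measure Ω} [IsProbabilityMeasure μ]

/-- A lower bound keeps the negative part integrable, so the difference defining `extIntegral` is
never `∞ - ∞`. -/
theorem lintegral_neg_toENNReal_le {g : Ω → EReal} {B : ℝ}
    (hB : ∀ ω, ((-B : ℝ) : EReal) ≤ g ω) : ∫⁻ ω, (-g ω).toENNReal ∂μ ≤ ENNReal.ofReal B := by
  refine (lintegral_mono fun ω => EReal.toENNReal_le_toENNReal (y := (B : EReal)) ?_).trans ?_
  · rw [EReal.neg_le, ← EReal.coe_neg]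
    exact hB ω
  · simp

theorem toReal_eq_sub_toENNReal {v : EReal} (hv : v ≠ ⊤) (hv' : v ≠ ⊥) :
    v.toReal = v.toENNReal.toReal - (-v).toENNReal.toReal := by
  lift v to ℝ using ⟨hv, hv'⟩
  rw [← EReal.coe_neg, EReal.real_coe_toENNReal, EReal.real_coe_toENNReal, EReal.toReal_coe,
    ENNReal.toReal_ofReal', ENNReal.toReal_ofReal']
  exact (max_zero_sub_eq_self v).symm

theorem extIntegral_of_lintegral_ne_top {g : Ω → EReal} (hg : Measurable g) {B : ℝ}
    (hB : ∀ ω, ((-B : ℝ) : EReal) ≤ g ω) (hP : ∫⁻ ω, (g ω).toENNReal ∂μ ≠ ⊤) :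
    (∀ᵐ ω ∂μ, g ω ≠ ⊤) ∧ Integrable (fun ω => (g ω).toReal) μ ∧
      extIntegral μ g = ((∫ ω, (g ω).toReal ∂μ : ℝ) : EReal) := by
  have hN : ∫⁻ ω, (-g ω).toENNReal ∂μ ≠ ⊤ :=
    ne_top_of_le_ne_top ENNReal.ofReal_ne_top (lintegral_neg_toENNReal_le hB)
  have hbot : ∀ ω, g ω ≠ ⊥ := fun ω =>
    ((EReal.bot_lt_coe _).trans_le (hB ω)).ne'
  have hm := hg.ereal_toENNReal
  have hm' : Measurable fun ω => (-g ω).toENNReal := hg.neg.ereal_toENNReal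
  have hPae := ae_lt_top hm hP
  have hNae := ae_lt_top hm' hN
  have hae : ∀ᵐ ω ∂μ, g ω ≠ ⊤ := by
    filter_upwards [hPae] with ω hω
    exact EReal.toENNReal_ne_top_iff.1 hω.ne
  have heq : (fun ω => (g ω).toReal) =ᵐ[μ]
      fun ω => (g ω).toENNReal.toReal - (-g ω).toENNReal.toReal := by
    filter_upwards [hae] with ω hω
    exact toReal_eq_sub_toENNReal hω (hbot ω)
  have hiP := integrable_toReal_of_lintegral_ne_top hm.aemeasurable hP
  have hiN := integrable_toReal_of_lintegral_ne_top hm'.aemeasurable hN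
  refine ⟨hae, (hiP.sub hiN).congr heq.symm, ?_⟩
  rw [integral_congr_ae heq, integral_sub hiP hiN, integral_toReal hm.aemeasurable hPae,
    integral_toReal hm'.aemeasurable hNae, EReal.coe_sub, EReal.coe_ennreal_toReal hP,
    EReal.coe_ennreal_toReal hN, extIntegral]

theorem extIntegral_of_lt_top {g : Ω → EReal} (hg : Measurable g) {B : ℝ}
    (hB : ∀ ω, ((-B : ℝ) : EReal) ≤ g ω) (h : extIntegral μ g < ⊤) :
    (∀ᵐ ω ∂μ, g ω ≠ ⊤) ∧ Integrable (fun ω => (g ω).toReal) μ ∧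
      extIntegral μ g = ((∫ ω, (g ω).toReal ∂μ : ℝ) : EReal) := by
  refine extIntegral_of_lintegral_ne_top hg hB fun hP => h.ne ?_
  rw [extIntegral, hP, EReal.coe_ennreal_top]
  refine EReal.top_sub ?_
  rw [Ne, EReal.coe_ennreal_eq_top_iff]
  exact ne_top_of_le_ne_top ENNReal.ofReal_ne_top (lintegral_neg_toENNReal_le hB)

theorem extIntegral_le_integral {g : Ω → EReal} (hg : Measurable g) {B : ℝ}
    (hB : ∀ ω, ((-B : ℝ) : EReal) ≤ g ω) {h : Ω → ℝ} (hh : Integrable h μ)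
    (hgh : ∀ᵐ ω ∂μ, g ω ≤ (h ω : EReal)) : extIntegral μ g ≤ ((∫ ω, h ω ∂μ : ℝ) : EReal) := by
  have hP : ∫⁻ ω, (g ω).toENNReal ∂μ ≠ ⊤ := by
    refine ne_top_of_le_ne_top hh.lintegral_lt_top.ne (lintegral_mono_ae ?_)
    filter_upwards [hgh] with ω hω
    simpa using EReal.toENNReal_le_toENNReal hω
  obtain ⟨hae, hint, heq⟩ := extIntegral_of_lintegral_ne_top hg hB hP
  rw [heq]
  norm_cast
  refine integral_mono_ae hint hh ?_
  filter_upwards [hgh] with ω hω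
  exact EReal.toReal_le_toReal hω ((EReal.bot_lt_coe _).trans_le (hB ω)).ne'
    (EReal.coe_ne_top _)

theorem toENNReal_add_coe {v : EReal} {B : ℝ} (hB0 : 0 ≤ B) (hB : ((-B : ℝ) : EReal) ≤ v) :
    (v + B).toENNReal + (-v).toENNReal = v.toENNReal + ENNReal.ofReal B := by
  induction v with
  | bot => exact absurd (le_bot_iff.1 hB) (EReal.coe_ne_bot _)
  | top => simp
  | coe v =>
    norm_cast at hB
    rw [← EReal.coe_add, ← EReal.coe_neg, EReal.real_coe_toENNReal, EReal.real_coe_toENNReal,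
      EReal.real_coe_toENNReal]
    rcases le_total 0 v with hv | hv
    · rw [ENNReal.ofReal_of_nonpos (neg_nonpos.2 hv), add_zero, ENNReal.ofReal_add hv hB0]
    · rw [← ENNReal.ofReal_add (by linarith) (by linarith), ENNReal.ofReal_of_nonpos hv, zero_add]
      congr 1
      ring

/-- Shifting by the lower bound leaves an integral of a nonnegative function, the form to which
Fatou's lemma applies. -/
theorem extIntegral_eq_lintegral_sub {g : Ω → EReal} (hg : Measurable g) {B : ℝ} (hB0 : 0 ≤ B)
    (hB : ∀ ω, ((-B : ℝ) : EReal) ≤ g ω) :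
    extIntegral μ g = ((∫⁻ ω, (g ω + B).toENNReal ∂μ : ℝ≥0∞) : EReal) - (B : EReal) := by
  have hN : ∫⁻ ω, (-g ω).toENNReal ∂μ ≠ ⊤ :=
    ne_top_of_le_ne_top ENNReal.ofReal_ne_top (lintegral_neg_toENNReal_le hB)
  have key : ∫⁻ ω, (g ω + B).toENNReal ∂μ + ∫⁻ ω, (-g ω).toENNReal ∂μ =
      ∫⁻ ω, (g ω).toENNReal ∂μ + ENNReal.ofReal B := by
    have hm : Measurable fun ω => (-g ω).toENNReal := hg.neg.ereal_toENNReal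
    rw [← lintegral_add_right _ hm]
    simp_rw [toENNReal_add_coe hB0 (hB _)]
    rw [lintegral_add_right _ measurable_const]
    simp
  rw [extIntegral]
  generalize ∫⁻ ω, (g ω + B).toENNReal ∂μ = H at *
  generalize ∫⁻ ω, (-g ω).toENNReal ∂μ = N at *
  generalize ∫⁻ ω, (g ω).toENNReal ∂μ = P at *
  lift N to ℝ≥0 using hN
  lift B to ℝ≥0 using hB0
  rw [ENNReal.ofReal_coe_nnreal] at key
  induction P with
  | top =>
    have hH : H = ⊤ := by simpa using key
    subst hH
    simp only [EReal.coe_ennreal_top, EReal.top_sub_coe]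
    exact EReal.top_sub (by simp)
  | coe P =>
    induction H with
    | top =>
      rw [top_add] at key
      exact absurd key.symm (ENNReal.add_ne_top.2 ⟨ENNReal.coe_ne_top, ENNReal.coe_ne_top⟩)
    | coe H =>
      norm_cast at key
      have key' : (H : ℝ) + N = P + B := by exact_mod_cast key
      change (((P : ℝ) : EReal) - ((N : ℝ) : EReal)) = ((H : ℝ) : EReal) - ((B : ℝ) : EReal)
      norm_cast
      linarith

end ExtIntegral

/-! ### The mean of the conjugate over `SO(n)` -/

theorem mem_orthogonalGroup_of_SO (ϑ : SO n) :
    (ϑ : Matrix (Fin n) (Fin n) ℝ) ∈ Matrix.orthogonalGroup (Fin n) ℝ :=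
  (Matrix.mem_specialOrthogonalGroup_iff.1 ϑ.2).1

theorem continuous_SO_inv_apply (x : E n) :
    Continuous fun ϑ : SO n =>
      Matrix.toEuclideanLin (ϑ : Matrix (Fin n) (Fin n) ℝ)⁻¹ x := by
  have : (fun ϑ : SO n => Matrix.toEuclideanLin (ϑ : Matrix (Fin n) (Fin n) ℝ)⁻¹ x) =
      fun ϑ : SO n => WithLp.toLp 2
        (Matrix.mulVec (ϑ : Matrix (Fin n) (Fin n) ℝ).transpose x.ofLp) := by
    funext ϑ
    rw [inv_eq_transpose (mem_orthogonalGroup_of_SO ϑ), Matrix.toLpLin_apply]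
  rw [this]
  exact (PiLp.continuous_toLp 2 _).comp
    (Continuous.matrix_mulVec continuous_subtype_val.matrix_transpose continuous_const)

/-- Proper, convex, lower semicontinuous functions on `ℝⁿ`. -/
structure IsClosedConvex (φ : E n → EReal) : Prop where
  ne_bot : ∀ x, φ x ≠ ⊥
  convex : Convex ℝ {p : E n × ℝ | φ p.1 ≤ (p.2 : EReal)}
  lsc : LowerSemicontinuous φ
  proper : ∃ x, φ x ≠ ⊤

theorem IsConvC.isClosedConvex_conj {ψ : E n → EReal} (hψ : IsConvC ψ) :
    IsClosedConvex (conj ψ) where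
  ne_bot := conj_ne_bot hψ.proper
  convex := convex_affineSup id ψ
  lsc := lowerSemicontinuous_of_isClosed_le_coe (isClosed_affineSup_le id ψ)
  proper := by
    obtain ⟨δ, hδ, M, hM⟩ := hψ.exists_conj_le
    exact ⟨0, ((hM 0 (by simpa using hδ.le)).trans_lt (EReal.coe_lt_top M)).ne⟩

/-- A closed convex function is bounded below by a negative multiple of `1 + ‖x‖`. -/
theorem IsClosedConvex.exists_lower_bound {φ : E n → EReal} (hφ : IsClosedConvex φ) :
    ∃ a b : ℝ, 0 ≤ a ∧ 0 ≤ b ∧ ∀ y, ((-(a * ‖y‖ + b) : ℝ) : EReal) ≤ φ y := by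
  obtain ⟨x, hx⟩ := hφ.proper
  lift φ x to ℝ using ⟨hx, hφ.ne_bot x⟩ with r hr
  obtain ⟨v, b, hmin, -⟩ := exists_affine_minorant hφ.ne_bot hφ.convex hφ.lsc hφ.proper
    (x₀ := x) (t₀ := r - 1) (by rw [← hr]; norm_cast; linarith)
  refine ⟨‖v‖, |b|, norm_nonneg v, abs_nonneg b, fun y => le_trans ?_ (hmin y)⟩
  have h1 := neg_le_of_abs_le (abs_real_inner_le_norm v y)
  have h2 := le_abs_self b
  norm_cast
  linarith

theorem measurable_rotate_SO {φ : E n → EReal} (hφ : LowerSemicontinuous φ) (x : E n) :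
    Measurable fun ϑ : SO n => rotate (ϑ : Matrix (Fin n) (Fin n) ℝ) φ x :=
  hφ.measurable.comp (continuous_SO_inv_apply x).measurable

theorem le_rotate_SO {φ : E n → EReal} {a b : ℝ}
    (h : ∀ y, ((-(a * ‖y‖ + b) : ℝ) : EReal) ≤ φ y) (x : E n) (ϑ : SO n) :
    ((-(a * ‖x‖ + b) : ℝ) : EReal) ≤ rotate (ϑ : Matrix (Fin n) (Fin n) ℝ) φ x := by
  rw [← norm_toEuclideanLin_inv (mem_orthogonalGroup_of_SO ϑ) x]
  exact h _

/-- `x ↦ ∫_{SO(n)} φ(ϑ⁻¹ x) dϑ`. -/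
def meanSO (φ : E n → EReal) : E n → EReal :=
  fun x => extIntegral (haarSO n) fun ϑ : SO n => rotate (ϑ : Matrix (Fin n) (Fin n) ℝ) φ x

theorem meanSO_of_lt_top {φ : E n → EReal} (hφ : IsClosedConvex φ) {x : E n}
    (hx : meanSO φ x < ⊤) :
    (∀ᵐ ϑ : SO n ∂haarSO n, rotate (ϑ : Matrix (Fin n) (Fin n) ℝ) φ x ≠ ⊤) ∧
      Integrable (fun ϑ : SO n => (rotate (ϑ : Matrix (Fin n) (Fin n) ℝ) φ x).toReal)
        (haarSO n) ∧
      meanSO φ x =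
        ((∫ ϑ : SO n, (rotate (ϑ : Matrix (Fin n) (Fin n) ℝ) φ x).toReal ∂haarSO n : ℝ) :
          EReal) := by
  obtain ⟨a, b, -, -, h⟩ := hφ.exists_lower_bound
  exact extIntegral_of_lt_top (measurable_rotate_SO hφ.lsc x) (le_rotate_SO h x) hx

theorem meanSO_le_integral {φ : E n → EReal} (hφ : IsClosedConvex φ) {x : E n} {h : SO n → ℝ}
    (hh : Integrable h (haarSO n))
    (hφh : ∀ᵐ ϑ : SO n ∂haarSO n,
      rotate (ϑ : Matrix (Fin n) (Fin n) ℝ) φ x ≤ (h ϑ : EReal)) :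
    meanSO φ x ≤ ((∫ ϑ, h ϑ ∂haarSO n : ℝ) : EReal) := by
  obtain ⟨a, b, -, -, hab⟩ := hφ.exists_lower_bound
  exact extIntegral_le_integral (measurable_rotate_SO hφ.lsc x) (le_rotate_SO hab x) hh hφh

theorem meanSO_le_of_ball {φ : E n → EReal} (hφ : IsClosedConvex φ) {s M : ℝ}
    (h : ∀ y, ‖y‖ ≤ s → φ y ≤ (M : EReal)) {x : E n} (hx : ‖x‖ ≤ s) :
    meanSO φ x ≤ (M : EReal) := by
  have := meanSO_le_integral hφ (x := x) (integrable_const M) (Eventually.of_forall fun ϑ =>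
    h _ ((norm_toEuclideanLin_inv (mem_orthogonalGroup_of_SO ϑ) x).le.trans hx))
  simpa using this

theorem meanSO_ne_bot {φ : E n → EReal} (hφ : IsClosedConvex φ) (x : E n) : meanSO φ x ≠ ⊥ := by
  intro h
  have := (meanSO_of_lt_top hφ (x := x) (h ▸ bot_lt_top)).2.2
  rw [h] at this
  exact EReal.coe_ne_bot _ this.symm

theorem convex_meanSO {φ : E n → EReal} (hφ : IsClosedConvex φ) :
    Convex ℝ {p : E n × ℝ | meanSO φ p.1 ≤ (p.2 : EReal)} := by
  rintro ⟨x, r⟩ hx ⟨y, s⟩ hy a b ha hb hab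
  simp only [mem_ofPred_eq, Prod.smul_mk, Prod.mk_add_mk, smul_eq_mul] at hx hy ⊢
  obtain ⟨hx1, hx2, hx3⟩ := meanSO_of_lt_top hφ (hx.trans_lt (EReal.coe_lt_top r))
  obtain ⟨hy1, hy2, hy3⟩ := meanSO_of_lt_top hφ (hy.trans_lt (EReal.coe_lt_top s))
  refine (meanSO_le_integral hφ ((hx2.const_mul a).add (hy2.const_mul b)) ?_).trans ?_
  · filter_upwards [hx1, hy1] with ϑ hϑx hϑy
    rw [rotate, map_add, map_smul, map_smul]
    exact coe_combo_le hφ.convex (EReal.le_coe_toReal hϑx) (EReal.le_coe_toReal hϑy) ha hb hab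
  · simp only [Pi.add_apply]
    rw [integral_add (hx2.const_mul a) (hy2.const_mul b), integral_const_mul, integral_const_mul]
    rw [hx3] at hx
    rw [hy3] at hy
    norm_cast at hx hy ⊢
    exact add_le_add (mul_le_mul_of_nonneg_left hx ha) (mul_le_mul_of_nonneg_left hy hb)

/-- The lower bound `-(a‖x‖ + b)` is rotation invariant and continuous. Adding `a‖x‖ + b` makes the
integrand nonnegative, Fatou's lemma gives lower semicontinuity, and subtracting it again does no
harm. -/
theorem lowerSemicontinuous_meanSO {φ : E n → EReal} (hφ : IsClosedConvex φ) :
    LowerSemicontinuous (meanSO φ) := by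
  obtain ⟨a, b, ha, hb, h⟩ := hφ.exists_lower_bound
  set B : E n → ℝ := fun x => a * ‖x‖ + b with hB
  have hBc : Continuous B := by fun_prop
  have hB0 : ∀ x, 0 ≤ B x := fun x => by positivity
  set k : SO n → E n → ℝ≥0∞ :=
    fun ϑ x => (rotate (ϑ : Matrix (Fin n) (Fin n) ℝ) φ x + B x).toENNReal with hk
  have hmeas : ∀ x, Measurable fun ϑ => k ϑ x := fun x =>
    ((measurable_rotate_SO hφ.lsc x).add_const _).ereal_toENNReal
  have hklsc : ∀ ϑ, LowerSemicontinuous (k ϑ) := by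
    intro ϑ
    refine EReal.continuous_toENNReal.comp_lowerSemicontinuous ?_
      fun _ _ h => EReal.toENNReal_le_toENNReal h
    refine LowerSemicontinuous.add' (hφ.lsc.comp (LinearMap.continuous_of_finiteDimensional _))
      (continuous_coe_real_ereal.comp hBc).lowerSemicontinuous fun x => ?_
    exact EReal.continuousAt_add (Or.inr (EReal.coe_ne_bot _)) (Or.inr (EReal.coe_ne_top _))
  have hH : LowerSemicontinuous fun x => ∫⁻ ϑ, k ϑ x ∂haarSO n := by
    rw [lowerSemicontinuous_iff_le_liminf]
    intro x
    refine (lintegral_mono fun ϑ => ?_).trans (lintegral_liminf_le hmeas)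
    exact lowerSemicontinuous_iff_le_liminf.1 (hklsc ϑ) x
  have heq : meanSO φ = fun x =>
      ((∫⁻ ϑ, k ϑ x ∂haarSO n : ℝ≥0∞) : EReal) + ((-B x : ℝ) : EReal) := by
    funext x
    rw [EReal.coe_neg, ← sub_eq_add_neg]
    exact extIntegral_eq_lintegral_sub (measurable_rotate_SO hφ.lsc x) (hB0 x) (le_rotate_SO h x)
  rw [heq]
  refine LowerSemicontinuous.add'
    (continuous_coe_ennreal_ereal.comp_lowerSemicontinuous hH
      fun _ _ h => EReal.coe_ennreal_le_coe_ennreal_iff.2 h)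
    (continuous_coe_real_ereal.comp hBc.neg).lowerSemicontinuous fun x => ?_
  exact EReal.continuousAt_add (Or.inr (EReal.coe_ne_bot _)) (Or.inr (EReal.coe_ne_top _))

theorem isClosedConvex_conjMean {ψ : E n → EReal} (hψ : IsConvC ψ) :
    IsClosedConvex (conjMean ψ) where
  ne_bot := meanSO_ne_bot hψ.isClosedConvex_conj
  convex := convex_meanSO hψ.isClosedConvex_conj
  lsc := lowerSemicontinuous_meanSO hψ.isClosedConvex_conj
  proper := by
    obtain ⟨δ, hδ, M, hM⟩ := hψ.exists_conj_le
    exact ⟨0, ((meanSO_le_of_ball hψ.isClosedConvex_conj hM (by simpa using hδ.le)).trans_lt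
      (EReal.coe_lt_top M)).ne⟩

theorem conj_conj_conjMean {ψ : E n → EReal} (hψ : IsConvC ψ) :
    conj (conj (conjMean ψ)) = conjMean ψ :=
  have h := isClosedConvex_conjMean hψ
  conj_conj h.ne_bot h.convex h.lsc h.proper

theorem isConvC_conj_conjMean {ψ : E n → EReal} (hψ : IsConvC ψ) :
    IsConvC (conj (conjMean ψ)) := by
  have h := isClosedConvex_conjMean hψ
  obtain ⟨δ, hδ, M, hM⟩ := hψ.exists_conj_le
  obtain ⟨x, hx⟩ := h.proper
  lift conjMean ψ x to ℝ using ⟨hx, h.ne_bot x⟩ with r hr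
  obtain ⟨v, b, hmin, -⟩ := exists_affine_minorant h.ne_bot h.convex h.lsc h.proper
    (x₀ := x) (t₀ := r - 1) (by rw [← hr]; norm_cast; linarith)
  exact isConvC_conj hδ (fun y hy => meanSO_le_of_ball hψ.isClosedConvex_conj hM hy) hmin

/-! ### Means over the motions -/

/-- `Φ` is a mean of the functions `φ ∘ ρ⁻¹`, `ρ ∈ motions n`: at finitely many points where `Φ` is
finite, its values lie in every closed convex set that contains the finite values of all
`φ ∘ ρ⁻¹`. -/
def IsMotionMean (φ Φ : E n → EReal) : Prop :=
  ∀ (m : ℕ) (p : Fin m → E n), (∀ i, Φ (p i) < ⊤) → ∀ C : Set (Fin m → ℝ), Convex ℝ C →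
    IsClosed C → (∀ ρ ∈ motions n, (∀ i, φ (Matrix.toEuclideanLin ρ⁻¹ (p i)) < ⊤) →
      (fun i => (φ (Matrix.toEuclideanLin ρ⁻¹ (p i))).toReal) ∈ C) →
    (fun i => (Φ (p i)).toReal) ∈ C

/-- The integral of an integrable `ℝᵐ`-valued map over a probability measure stays in every closed
convex set containing almost all its values. Finiteness of the means makes the entries finite almost
everywhere, simultaneously for the finitely many points. -/
theorem isMotionMean_meanSO (hn : n ≠ 1) {φ : E n → EReal} (hφ : IsClosedConvex φ) :
    IsMotionMean φ (meanSO φ) := by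
  intro m p hp C hC hCc h
  have hint : ∀ i, Integrable
      (fun ϑ : SO n => (rotate (ϑ : Matrix (Fin n) (Fin n) ℝ) φ (p i)).toReal) (haarSO n) :=
    fun i => (meanSO_of_lt_top hφ (hp i)).2.1
  have heq : (fun i => (meanSO φ (p i)).toReal) =
      ∫ ϑ : SO n, (fun i => (rotate (ϑ : Matrix (Fin n) (Fin n) ℝ) φ (p i)).toReal)
        ∂haarSO n := by
    funext i
    rw [eval_integral hint, (meanSO_of_lt_top hφ (hp i)).2.2, EReal.toReal_coe]
  rw [heq]
  refine hC.integral_mem hCc ?_ (Integrable.of_eval hint)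
  filter_upwards [ae_all_iff.2 fun i => (meanSO_of_lt_top hφ (hp i)).1] with ϑ hϑ
  refine h ϑ ?_ fun i => lt_top_iff_ne_top.2 (hϑ i)
  rw [motions, if_neg hn]
  exact ϑ.2

/-! ### The symmetrization on the line -/

theorem IsConvC.comp_neg {ψ : E n → EReal} (hψ : IsConvC ψ) : IsConvC fun x => ψ (-x) := by
  refine IsConvC.of_isCompact (fun x => hψ.ne_bot _) ?_ ?_ fun t => ?_
  · exact hψ.convex.linear_preimage
      ((-LinearMap.id : E n →ₗ[ℝ] E n).prodMap (LinearMap.id : ℝ →ₗ[ℝ] ℝ))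
  · obtain ⟨x, hx⟩ := hψ.proper
    exact ⟨-x, by rwa [neg_neg]⟩
  · exact (Homeomorph.neg (E n)).isClosedEmbedding.isCompact_preimage (hψ.isCompact_le t)

/-- The mean of `ψ` and its reflection with respect to epi-addition. -/
def epiHalf (ψ : E n → EReal) : E n → EReal :=
  epiMul (1 / 2) (infConv ψ (fun x => ψ (-x)))

theorem IsConvC.epiHalf {ψ : E n → EReal} (hψ : IsConvC ψ) : IsConvC (epiHalf ψ) :=
  (hψ.infConv hψ.comp_neg).epiMul (by norm_num)

theorem conj_epiHalf_le {ψ : E n → EReal} (hψ : IsConvC ψ) {y : E n} {A B : ℝ}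
    (hA : conj ψ y ≤ (A : EReal)) (hB : conj ψ (-y) ≤ (B : EReal)) :
    conj (epiHalf ψ) y ≤ ((1 / 2 * A + 1 / 2 * B : ℝ) : EReal) := by
  rw [conj_le_coe_iff]
  refine fun x => le_of_forall_epigraph fun t ht => le_of_forall_pos_le_add fun ε hε => ?_
  rw [epiHalf, epiMul, coe_mul_le_coe_iff (by norm_num)] at ht
  obtain ⟨w, hw⟩ := (infConv_lt_coe_iff _ _ _ (2 * t + 2 * ε)).1
    (ht.trans_lt (by norm_cast; norm_num; linarith))
  obtain ⟨s, s', hs, hs', hlt⟩ := exists_coe_of_add_lt (hψ.ne_bot _) (hψ.ne_bot _) hw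
  have h1 := coe_le_of_conj_le_coe hA hs.le
  have h2 := coe_le_of_conj_le_coe hB hs'.le
  rw [inner_sub_right, real_inner_smul_right] at h1
  rw [inner_neg_neg] at h2
  norm_num at h1
  linarith

theorem inner_sub_le_of_conj_epiHalf_le {ψ : E n → EReal} {y u v : E n} {r s t : ℝ}
    (hr : conj (epiHalf ψ) y ≤ (r : EReal)) (hs : ψ u ≤ (s : EReal)) (ht : ψ v ≤ (t : EReal)) :
    inner ℝ y u - inner ℝ y v ≤ 2 * r + s + t := by
  have hle : epiHalf ψ ((1 / 2 : ℝ) • (u - v)) ≤ ((1 / 2 * (s + t) : ℝ) : EReal) := by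
    rw [epiHalf, epiMul, coe_mul_le_coe_iff (by norm_num), inv_smul_smul₀ (by norm_num),
      inv_mul_cancel_left₀ (by norm_num), EReal.coe_add]
    refine (iInf_le _ (-v)).trans ?_
    simp only [neg_neg, sub_neg_eq_add, sub_add_cancel]
    exact add_le_add hs ht
  have := coe_le_of_conj_le_coe hr hle
  rw [real_inner_smul_right, inner_sub_right] at this
  linarith

/-- Conjugation turns epi-addition into addition. In the joint bound on `⟨y, u⟩ - ⟨y, v⟩`, the
supremum over `u` for fixed `v` shows `conj ψ y` finite; the supremum over `v` then handles `-y`. -/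
theorem conj_epiHalf_of_lt_top {ψ : E n → EReal} (hψ : IsConvC ψ) {y : E n}
    (hy : conj (epiHalf ψ) y < ⊤) :
    conj ψ y < ⊤ ∧ conj ψ (-y) < ⊤ ∧ (conj (epiHalf ψ) y).toReal =
      1 / 2 * (conj ψ y).toReal + 1 / 2 * (conj ψ (-y)).toReal := by
  have hr := (EReal.coe_toReal hy.ne (conj_ne_bot hψ.epiHalf.proper y)).symm
  set r := (conj (epiHalf ψ) y).toReal
  obtain ⟨v, t, ht⟩ := hψ.exists_coe
  have h1 : ∀ v (t : ℝ), ψ v ≤ (t : EReal) →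
      conj ψ y ≤ ((2 * r + inner ℝ y v + t : ℝ) : EReal) := by
    intro v t ht
    rw [conj_le_coe_iff]
    refine fun u => le_of_forall_epigraph fun s hs => ?_
    linarith [inner_sub_le_of_conj_epiHalf_le hr.le hs ht]
  have hy1 : conj ψ y < ⊤ := (h1 v t ht.le).trans_lt (EReal.coe_lt_top _)
  have hA := (EReal.coe_toReal hy1.ne (conj_ne_bot hψ.proper y)).symm
  set A := (conj ψ y).toReal
  have h2 : conj ψ (-y) ≤ ((2 * r - A : ℝ) : EReal) := by
    rw [conj_le_coe_iff]
    refine fun v => le_of_forall_epigraph fun t ht => ?_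
    have := h1 v t ht
    rw [hA] at this
    norm_cast at this
    rw [inner_neg_left]
    linarith
  have hy2 : conj ψ (-y) < ⊤ := h2.trans_lt (EReal.coe_lt_top _)
  have hB := (EReal.coe_toReal hy2.ne (conj_ne_bot hψ.proper (-y))).symm
  set B := (conj ψ (-y)).toReal
  have h3 := conj_epiHalf_le hψ hA.le hB.le
  rw [hr] at h3
  rw [hB] at h2
  norm_cast at h2 h3
  exact ⟨hy1, hy2, by linarith⟩

theorem toEuclideanLin_inv_one (x : E n) :
    Matrix.toEuclideanLin (1 : Matrix (Fin n) (Fin n) ℝ)⁻¹ x = x := by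
  rw [inv_one, Matrix.toLpLin_one]
  rfl

theorem neg_one_mem_orthogonalGroup :
    (-1 : Matrix (Fin n) (Fin n) ℝ) ∈ Matrix.orthogonalGroup (Fin n) ℝ := by
  rw [Matrix.mem_orthogonalGroup_iff]
  simp

theorem toEuclideanLin_inv_neg_one (x : E n) :
    Matrix.toEuclideanLin (-1 : Matrix (Fin n) (Fin n) ℝ)⁻¹ x = -x := by
  rw [inv_eq_transpose neg_one_mem_orthogonalGroup, Matrix.transpose_neg, Matrix.transpose_one,
    map_neg, Matrix.toLpLin_one]
  rfl

theorem isMotionMean_epiHalf (hn : n = 1) {ψ : E n → EReal} (hψ : IsConvC ψ) :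
    IsMotionMean (conj ψ) (conj (epiHalf ψ)) := by
  intro m p hp C hC _ h
  have h1 := h 1 (by rw [motions, if_pos hn]; exact one_mem _)
  have h2 := h (-1) (by rw [motions, if_pos hn]; exact neg_one_mem_orthogonalGroup)
  simp only [toEuclideanLin_inv_one, toEuclideanLin_inv_neg_one] at h1 h2
  have key := fun i => conj_epiHalf_of_lt_top hψ (hp i)
  have := hC (h1 fun i => (key i).1) (h2 fun i => (key i).2.1) (a := 1 / 2) (b := 1 / 2)
    (by norm_num) (by norm_num) (by norm_num)
  convert this using 1
  funext i
  rw [(key i).2.2]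
  rfl

/-! ### The rotational epi-symmetrization -/

theorem epiRot_of_eq_one (hn : n = 1) (ψ : E n → EReal) : epiRot ψ = epiHalf ψ := by
  rw [epiRot, if_pos hn, epiHalf]

theorem epiRot_of_ne_one (hn : n ≠ 1) (ψ : E n → EReal) : epiRot ψ = conj (conjMean ψ) := by
  rw [epiRot, if_neg hn]

theorem conj_epiRot_of_ne_one (hn : n ≠ 1) {ψ : E n → EReal} (hψ : IsConvC ψ) :
    conj (epiRot ψ) = conjMean ψ := by
  rw [epiRot_of_ne_one hn, conj_conj_conjMean hψ]

theorem IsConvC.epiRot {ψ : E n → EReal} (hψ : IsConvC ψ) : IsConvC (epiRot ψ) := by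
  by_cases hn : n = 1
  · rw [epiRot_of_eq_one hn]
    exact hψ.epiHalf
  · rw [epiRot_of_ne_one hn]
    exact isConvC_conj_conjMean hψ

theorem isMotionMean_epiRot {ψ : E n → EReal} (hψ : IsConvC ψ) :
    IsMotionMean (conj ψ) (conj (epiRot ψ)) := by
  by_cases hn : n = 1
  · rw [epiRot_of_eq_one hn]
    exact isMotionMean_epiHalf hn hψ
  · rw [conj_epiRot_of_ne_one hn hψ]
    exact isMotionMean_meanSO hn hψ.isClosedConvex_conj

theorem conj_epiRot_le_of_ball {ψ : E n → EReal} (hψ : IsConvC ψ) {s M : ℝ}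
    (h : ∀ y, ‖y‖ ≤ s → conj ψ y ≤ (M : EReal)) {x : E n} (hx : ‖x‖ ≤ s) :
    conj (epiRot ψ) x ≤ (M : EReal) := by
  by_cases hn : n = 1
  · rw [epiRot_of_eq_one hn]
    refine (conj_epiHalf_le hψ (h x hx) (h (-x) (by rwa [norm_neg]))).trans_eq ?_
    congr 1
    ring
  · rw [conj_epiRot_of_ne_one hn hψ]
    exact meanSO_le_of_ball hψ.isClosedConvex_conj h hx

/-- Finiteness of `conj ψ` on a ball does not by itself bound its mean; the strict inequality
defining the open ball leaves room for a smaller ball on which `conj ψ` is bounded. -/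
theorem openInnerBall_subset_epiRot {ψ : E n → EReal} (hψ : IsConvC ψ) :
    openInnerBall ψ ⊆ openInnerBall (epiRot ψ) := by
  intro x hx
  obtain ⟨r, hr, hxr⟩ := exists_ball_of_mem_openInnerBall hx
  obtain ⟨s, hxs, hsr⟩ := exists_between hxr
  obtain ⟨M, hM⟩ := exists_le_on_smaller_ball hψ.isClosedConvex_conj.ne_bot
    hψ.isClosedConvex_conj.convex hsr hr
  exact mem_openInnerBall_of_ball hxs fun y hy =>
    (conj_epiRot_le_of_ball hψ hM (mem_closedBall_zero_iff.1 hy)).trans_lt (EReal.coe_lt_top M)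

theorem admissible_subset_epiRot {ψ : E n → EReal} (hψ : IsConvC ψ) :
    admissible ψ ⊆ admissible (epiRot ψ) := by
  rintro Y ⟨Y₀, hsub, hhull, hball⟩
  exact ⟨Y₀, hsub, hhull, hball.trans (openInnerBall_subset_epiRot hψ)⟩

/-! ### Finite suprema of affine functions -/

theorem continuous_affineSup_coe {m : ℕ} (z : Fin m → E n) :
    Continuous fun q : (Fin m → ℝ) × E n => affineSup z (fun i => (q.1 i : EReal)) q.2 := by
  simp only [affineSup, ← Finset.sup_univ_eq_iSup, ← EReal.coe_sub]
  refine Continuous.finset_sup_apply fun i _ => continuous_coe_real_ereal.comp ?_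
  fun_prop

theorem continuous_affineSup_coe_right {m : ℕ} (z : Fin m → E n) (g : Fin m → ℝ) :
    Continuous fun x => affineSup z (fun i => (g i : EReal)) x := by
  have h : Continuous fun x : E n => (g, x) := by fun_prop
  have h' := (continuous_affineSup_coe z).comp h
  exact h'

theorem isConvC_affineSup_coe {m : ℕ} {z : Fin m → E n} {δ : ℝ} (hδ : 0 < δ)
    (hz : ∀ x, ∃ i, δ * ‖x‖ ≤ inner ℝ x (z i)) (g : Fin m → ℝ) :
    IsConvC (affineSup z fun i => (g i : EReal)) := by
  obtain ⟨M, hM⟩ := (finite_range g).bddAbove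
  obtain ⟨b, hb⟩ := (finite_range g).bddBelow
  refine isConvC_affineSup z _ ⟨0, ?_⟩ hδ (M := M) fun x => ?_
  · have : affineSup z (fun i => (g i : EReal)) 0 ≤ ((-b : ℝ) : EReal) := by
      rw [affineSup_le_coe_iff]
      intro i
      have := hb (mem_range_self i)
      rw [inner_zero_left]
      norm_cast
      linarith
    exact (this.trans_lt (EReal.coe_lt_top _)).ne
  · obtain ⟨i, hi⟩ := hz x
    exact ⟨i, by exact_mod_cast hM (mem_range_self i), hi⟩

/-- For any splitting of `x`, each affine piece with averaged intercept is exactly the sum of the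
two scaled pieces with the same slope, and each of those is below its own supremum. -/
theorem affineSup_combo_le {m : ℕ} (z : Fin m → E n) (g h : Fin m → ℝ) {a : ℝ} (ha : 0 < a)
    (ha1 : a < 1) (x : E n) :
    affineSup z (fun i => ((a • g + (1 - a) • h) i : ℝ)) x ≤
      infConv (epiMul (1 - a) (affineSup z fun i => (h i : EReal)))
        (epiMul a (affineSup z fun i => (g i : EReal))) x := by
  have hb : 0 < 1 - a := sub_pos.2 ha1
  refine iSup_le fun i => le_iInf fun y => ?_
  have hle : ∀ (k : Fin m → ℝ) w, ((inner ℝ w (z i) - k i : ℝ) : EReal) ≤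
      affineSup z (fun i => (k i : EReal)) w := fun k w =>
    le_iSup (fun i => ((inner ℝ w (z i) : ℝ) : EReal) - (k i : EReal)) i
  have h1 := mul_le_mul_of_nonneg_left (hle g (a⁻¹ • y)) (EReal.coe_nonneg.2 ha.le)
  have h2 := mul_le_mul_of_nonneg_left (hle h ((1 - a)⁻¹ • (x - y))) (EReal.coe_nonneg.2 hb.le)
  refine le_trans (le_of_eq ?_) (add_le_add h2 h1)
  beta_reduce
  rw [← EReal.coe_sub, ← EReal.coe_mul, ← EReal.coe_mul, ← EReal.coe_add]
  congr 1
  simp only [real_inner_smul_left, inner_sub_left, Pi.add_apply, Pi.smul_apply, smul_eq_mul]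
  field_simp
  ring

theorem expNeg_mem_LCc {ψ : E n → EReal} (hψ : IsConvC ψ) : expNeg ψ ∈ LCc n := ⟨ψ, hψ, rfl⟩

theorem expNeg_le_expNeg {ψ₁ ψ₂ : E n → EReal} (h : ∀ x, ψ₁ x ≤ ψ₂ x) : expNeg ψ₂ ≤ expNeg ψ₁ :=
  fun x => EReal.exp_monotone (EReal.neg_le_neg_iff.2 (h x))

theorem continuous_exp_neg : Continuous fun v : EReal => EReal.exp (-v) :=
  ENNReal.continuous_exp.comp continuous_neg

/-! ### Superlevel sets of the functional -/

section Functional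
variable {F : (E n → ℝ≥0∞) → ℝ≥0∞} {m : ℕ} {z : Fin m → E n} {δ : ℝ}

/-- Averaging intercepts gives a function above the Asplund combination (`affineSup_combo_le`), so
monotonicity and log-concavity combine. -/
theorem convex_superlevel (hlog : AsplundLogConcave F) (hmono : MonotoneOn F (LCc n))
    (hδ : 0 < δ) (hz : ∀ x, ∃ i, δ * ‖x‖ ≤ inner ℝ x (z i)) (c : ℝ≥0∞) :
    Convex ℝ {g : Fin m → ℝ | c ≤ F (expNeg (affineSup z fun i => (g i : EReal)))} := by
  rw [convex_iff_forall_pos]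
  intro g hg h hh a b ha hb hab
  obtain rfl : b = 1 - a := by linarith
  have hg' := isConvC_affineSup_coe hδ hz g
  have hh' := isConvC_affineSup_coe hδ hz h
  have hconv := (hh'.epiMul hb).infConv (hg'.epiMul ha)
  have h1 := hlog _ (expNeg_mem_LCc hg') _ (expNeg_mem_LCc hh') a ha (by linarith)
  rw [homothety_expNeg, homothety_expNeg,
    asplund_expNeg (hg'.epiMul ha).ne_bot (hh'.epiMul hb).ne_bot] at h1
  have h2 := hmono (expNeg_mem_LCc hconv)
    (expNeg_mem_LCc (isConvC_affineSup_coe hδ hz (a • g + (1 - a) • h)))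
    (expNeg_le_expNeg (affineSup_combo_le z g h ha (by linarith)))
  refine le_trans ?_ (h1.trans h2)
  calc c = c ^ a * c ^ (1 - a) := by
        rw [← ENNReal.rpow_add_of_nonneg _ _ ha.le hb.le, add_sub_cancel, ENNReal.rpow_one]
    _ ≤ _ := mul_le_mul' (ENNReal.rpow_le_rpow hg ha.le) (ENNReal.rpow_le_rpow hh hb.le)

/-- A finite maximum is jointly continuous in the intercepts and the point, so convergence of
intercepts implies hypo-convergence. -/
theorem isClosed_superlevel (husc : HypoUSC F) (hδ : 0 < δ)
    (hz : ∀ x, ∃ i, δ * ‖x‖ ≤ inner ℝ x (z i)) (c : ℝ≥0∞) :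
    IsClosed {g : Fin m → ℝ | c ≤ F (expNeg (affineSup z fun i => (g i : EReal)))} := by
  refine IsSeqClosed.isClosed fun gs g hgs hlim => ?_
  have key : ∀ (x : E n) (xs : ℕ → E n), Tendsto xs atTop (𝓝 x) →
      Tendsto (fun j => expNeg (affineSup z fun i => (gs j i : EReal)) (xs j)) atTop
        (𝓝 (expNeg (affineSup z fun i => (g i : EReal)) x)) := by
    intro x xs hxs
    have h1 := continuous_exp_neg.comp (continuous_affineSup_coe z)
    have h2 := (h1.tendsto (g, x)).comp (hlim.prodMk_nhds hxs)
    exact h2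
  have h := husc (fun j => expNeg (affineSup z fun i => (gs j i : EReal)))
    (expNeg (affineSup z fun i => (g i : EReal)))
    (fun j => expNeg_mem_LCc (isConvC_affineSup_coe hδ hz _))
    (expNeg_mem_LCc (isConvC_affineSup_coe hδ hz _))
    (fun x => ⟨fun xs hxs => (key x xs hxs).limsup_eq.le,
      fun _ => x, tendsto_const_nhds, key x _ tendsto_const_nhds⟩)
  exact (le_limsup_of_frequently_le' (Frequently.of_forall hgs)).trans h

theorem hypoTendsto_of_monotone {Q : ℕ → E n → EReal} (hQ : Monotone Q)
    (hc : ∀ k, Continuous (Q k)) :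
    HypoTendsto (fun k => expNeg (Q k)) (expNeg fun x => ⨆ k, Q k x) := by
  intro x
  have hlim : Tendsto (fun k => expNeg (Q k) x) atTop (𝓝 (expNeg (fun x => ⨆ k, Q k x) x)) :=
    (continuous_exp_neg.tendsto _).comp (tendsto_atTop_iSup fun i j hij => hQ hij x)
  refine ⟨fun xs hxs => ?_, fun _ => x, tendsto_const_nhds, hlim⟩
  -- Compare the tail of the sequence with one fixed continuous `Q k`, then let `k` tend to
  -- infinity.
  refine ge_of_tendsto' hlim fun k => ?_
  have hk : Tendsto (fun j => expNeg (Q k) (xs j)) atTop (𝓝 (expNeg (Q k) x)) :=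
    ((continuous_exp_neg.comp (hc k)).tendsto x).comp hxs
  rw [← hk.limsup_eq]
  refine limsup_le_limsup ?_
  filter_upwards [eventually_ge_atTop k] with j hj
  exact expNeg_le_expNeg (fun y => hQ hj y) (xs j)

end Functional

/-! ### Approximation of outer linearizations by finite suprema -/

theorem exists_seq_outerLin (ψ : E n → EReal) (hψ : ∃ x, ψ x ≠ ⊤) (Y Z : Set (E n)) (hZY : Z ⊆ Y)
    (hZ : Z.Finite) (hZne : Z.Nonempty) (hfin : ∀ z ∈ Z, conj ψ z < ⊤) :
    ∃ e : ℕ → E n, (∀ k, e k ∈ Y ∧ conj ψ (e k) < ⊤) ∧ (∃ N, ∀ z ∈ Z, ∃ k < N, e k = z) ∧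
      ∀ x (r : ℝ), (∀ k, ((inner ℝ x (e k) - r : ℝ) : EReal) ≤ conj ψ (e k)) →
        outerLin ψ Y x ≤ (r : EReal) := by
  set S : Set (E n × ℝ) := (fun y => (y, (conj ψ y).toReal)) '' {y | y ∈ Y ∧ conj ψ y < ⊤}
    with hS
  -- Density is taken in the graph of `conj ψ` over `Y`, since `conj ψ` need not be continuous along
  -- `Y`; the constraint `⟨x, y⟩ - r ≤ t` is closed in `(y, t)`.
  obtain ⟨T, hTS, hT, hST⟩ :=
    (TopologicalSpace.IsSeparable.of_separableSpace S).exists_countable_dense_subset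
  obtain ⟨e, he⟩ := ((hT.image Prod.fst).union hZ.countable).exists_eq_range
    (hZne.mono subset_union_right)
  have hmem : ∀ k, e k ∈ Prod.fst '' T ∪ Z := fun k => he ▸ mem_range_self k
  refine ⟨e, fun k => ?_, ?_, fun x r h => ?_⟩
  · rcases hmem k with ⟨p, hp, hpk⟩ | hk
    · obtain ⟨y, hy, rfl⟩ := hTS hp
      exact hpk ▸ hy
    · exact ⟨hZY hk, hfin _ hk⟩
  · have : ∀ z ∈ Z, ∃ k, e k = z := fun z hz => by
      have : z ∈ range e := he ▸ Or.inr hz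
      exact this
    choose! k hk using this
    obtain ⟨N, hN⟩ := (hZ.image k).bddAbove
    exact ⟨N + 1, fun z hz => ⟨k z, Nat.lt_succ_of_le (hN (mem_image_of_mem k hz)), hk z hz⟩⟩
  · rw [outerLin_eq_affineSup, affineSup_le_coe_iff]
    rintro ⟨y, hy⟩
    rcases eq_or_ne (conj ψ y) ⊤ with htop | htop
    · simp [htop]
    · have hcl : IsClosed {p : E n × ℝ | inner ℝ x p.1 - r ≤ p.2} :=
        isClosed_le (by fun_prop) (by fun_prop)
      have hsub : T ⊆ {p : E n × ℝ | inner ℝ x p.1 - r ≤ p.2} := by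
        intro p hp
        obtain ⟨y, hy, rfl⟩ := hTS hp
        have : y ∈ range e := he ▸ Or.inl ⟨_, hp, rfl⟩
        obtain ⟨k, rfl⟩ := this
        have hk := h k
        rw [← EReal.coe_toReal hy.2.ne (conj_ne_bot hψ _)] at hk
        exact_mod_cast hk
      have := hcl.closure_subset_iff.2 hsub
        (hST (mem_image_of_mem _ (show y ∈ _ from ⟨hy, lt_top_iff_ne_top.2 htop⟩)))
      rw [← EReal.coe_toReal htop (conj_ne_bot hψ _)]
      exact_mod_cast this

/-- Lower bounds for an upper semicontinuous functional at an outer linearization follow from those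
at finite outer linearizations. -/
theorem le_functional_outerLin {F : (E n → ℝ≥0∞) → ℝ≥0∞} (husc : HypoUSC F) {ψ : E n → EReal}
    (hψ : ∃ x, ψ x ≠ ⊤) {Y Z : Set (E n)} (hZY : Z ⊆ Y) (hZ : Z.Finite)
    (hfin : ∀ z ∈ Z, conj ψ z < ⊤) {δ : ℝ} (hδ : 0 < δ)
    (hgrow : ∀ x, ∃ z ∈ Z, δ * ‖x‖ ≤ inner ℝ x z) (hY : IsConvC (outerLin ψ Y)) {c : ℝ≥0∞}
    (hc : ∀ (m : ℕ) (p : Fin m → E n), (∀ i, p i ∈ Y ∧ conj ψ (p i) < ⊤) →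
      (∀ x, ∃ i, δ * ‖x‖ ≤ inner ℝ x (p i)) →
      c ≤ F (expNeg (affineSup p fun i => ((conj ψ (p i)).toReal : EReal)))) :
    c ≤ F (expNeg (outerLin ψ Y)) := by
  obtain ⟨z₀, hz₀, -⟩ := hgrow 0
  obtain ⟨e, he, ⟨N, hN⟩, hsup⟩ := exists_seq_outerLin ψ hψ Y Z hZY hZ ⟨z₀, hz₀⟩ hfin
  -- The first `N` slopes already contain `Z`, so every finite stage grows with the same `δ`.
  set p : (k : ℕ) → Fin (N + k) → E n := fun _ i => e i with hp
  set Q : ℕ → E n → EReal :=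
    fun k => affineSup (p k) fun i => ((conj ψ (p k i)).toReal : EReal) with hQ
  have hpgrow : ∀ k x, ∃ i, δ * ‖x‖ ≤ inner ℝ x (p k i) := by
    intro k x
    obtain ⟨z, hz, hxz⟩ := hgrow x
    obtain ⟨j, hj, rfl⟩ := hN z hz
    exact ⟨⟨j, by omega⟩, hxz⟩
  have hmono : Monotone Q := by
    intro k l hkl x
    refine iSup_le fun i => ?_
    exact le_iSup (fun i => ((inner ℝ x (p l i) : ℝ) : EReal) -
      ((conj ψ (p l i)).toReal : EReal)) ⟨i, by omega⟩
  have hcoe : ∀ k, ((conj ψ (e k)).toReal : EReal) = conj ψ (e k) := fun k =>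
    EReal.coe_toReal (he k).2.ne (conj_ne_bot hψ _)
  have heq : outerLin ψ Y = fun x => ⨆ k, Q k x := by
    funext x
    refine eq_of_forall_le_coe_iff fun r => ⟨fun h => iSup_le fun k => ?_, fun h => ?_⟩
    · rw [outerLin_eq_affineSup, affineSup_le_coe_iff] at h
      rw [hQ, affineSup_le_coe_iff]
      intro i
      rw [hcoe]
      exact h ⟨e i, (he i).1⟩
    · refine hsup x r fun k => ?_
      have := (affineSup_le_coe_iff _ _ x r).1 ((le_iSup (fun k => Q k x) (k + 1)).trans h)
        ⟨k, by omega⟩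
      rwa [hcoe] at this
  have hlim := husc (fun k => expNeg (Q k)) (expNeg (outerLin ψ Y))
    (fun k => expNeg_mem_LCc (isConvC_affineSup_coe hδ (hpgrow k) _)) (expNeg_mem_LCc hY)
    (heq ▸ hypoTendsto_of_monotone hmono fun k => continuous_affineSup_coe_right _ _)
  refine (le_limsup_of_frequently_le' (Frequently.of_forall fun k => ?_)).trans hlim
  exact hc (N + k) (p k) (fun i => he i) (hpgrow k)

/-! ### The extremal inequality -/

theorem Fstar_le_of_isMotionMean (hn : 1 ≤ n) {F : (E n → ℝ≥0∞) → ℝ≥0∞} (husc : HypoUSC F)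
    (hlog : AsplundLogConcave F) (hmono : MonotoneOn F (LCc n)) {ψ Ψ : E n → EReal}
    (hψ : IsConvC ψ) (hΨ : IsConvC Ψ) (hmean : IsMotionMean (conj ψ) (conj Ψ))
    {𝒴 : Set (Set (E n))} (h𝒴 : 𝒴 ⊆ admissible ψ) (h𝒴' : 𝒴 ⊆ admissible Ψ) :
    Fstar F (expNeg ψ) 𝒴 ≤ Fstar F (expNeg Ψ) 𝒴 := by
  conv_rhs => rw [Fstar, negLog_expNeg]
  refine le_iInf₂ fun ϑ hϑ => le_iInf₂ fun Y hY => ?_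
  have hϑO := motions_subset hϑ
  obtain ⟨Y₀, hsub, hhull, hball⟩ := h𝒴' hY
  obtain ⟨Z, hZY, hZ, δ, hδ, hgrow⟩ := exists_finite_positively_spanning hn hhull
  refine le_functional_outerLin husc (exists_rotate_ne_top hϑO hΨ.proper) (hZY.trans hsub) hZ
    (fun z hz => ?_) hδ hgrow (isConvC_outerLin_rotate hn hΨ (h𝒴' hY) hϑO) fun m p hp hpgrow => ?_
  · rw [conj_rotate hϑO]
    exact lt_top_of_mem_openInnerBall (hball (hZY hz)) (norm_toEuclideanLin_inv hϑO z).le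
  simp only [conj_rotate hϑO] at hp ⊢
  -- The closed convex set is the superlevel set at `c = F*(f, 𝒴)`; it remains to place in it the
  -- vector of each single motion `ρ`.
  refine hmean m (fun i => Matrix.toEuclideanLin ϑ⁻¹ (p i)) (fun i => (hp i).2) _
    (convex_superlevel hlog hmono hδ hpgrow _) (isClosed_superlevel husc hδ hpgrow _)
    fun ρ hρ hfin => ?_
  have hmul := mul_mem_motions hϑ hρ
  have hmulO := motions_subset hmul
  simp only [← toEuclideanLin_inv_mul, ← conj_rotate hmulO] at hfin ⊢
  have h1 : Fstar F (expNeg ψ) 𝒴 ≤ F (expNeg (outerLin (rotate (ϑ * ρ) ψ) Y)) := by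
    rw [Fstar, negLog_expNeg]
    exact (iInf₂_le (ϑ * ρ) hmul).trans (iInf₂_le Y hY)
  -- The finite maximum uses only some slopes of `Y`, so it lies below the full linearization of `ψ
  -- ∘ (ϑρ)⁻¹`, and `F` is at least as large there.
  refine h1.trans (hmono (expNeg_mem_LCc (isConvC_outerLin_rotate hn hψ (h𝒴 hY) hmulO))
    (expNeg_mem_LCc (isConvC_affineSup_coe hδ hpgrow _)) (expNeg_le_expNeg fun x => ?_))
  rw [outerLin_eq_affineSup]
  refine iSup_le fun i => ?_
  beta_reduce
  rw [EReal.coe_toReal (hfin i).ne (conj_ne_bot (exists_rotate_ne_top hmulO hψ.proper) _)]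
  exact le_iSup (fun y : Y => ((inner ℝ x (y : E n) : ℝ) : EReal) -
    conj (rotate (ϑ * ρ) ψ) y) ⟨p i, (hp i).1⟩

end OuterLin

end

theorem mainTheorem6 (n : ℕ) (hn : 1 ≤ n)
    -- a functional `F : LC_c(ℝⁿ) → [0, ∞]`: only its values on `LCc n` enter below
    (F : (OuterLin.E n → ℝ≥0∞) → ℝ≥0∞)
    (hF : ¬ ((∃ f ∈ OuterLin.LCc n, F f = 0) ∧ (∃ f ∈ OuterLin.LCc n, F f = ⊤)))
    (hF_usc : OuterLin.HypoUSC F)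
    (hF_logconcave : OuterLin.AsplundLogConcave F)
    (hF_mono : MonotoneOn F (OuterLin.LCc n))
    (ψ : OuterLin.E n → EReal) (hψ : OuterLin.IsConvC ψ)
    (f : OuterLin.E n → ℝ≥0∞) (hf : f = OuterLin.expNeg ψ)
    (𝒴 : Set (Set (OuterLin.E n))) (h𝒴 : 𝒴 ⊆ OuterLin.admissible ψ) :
    -- the symmetrization is well defined
    (OuterLin.IsConvC (OuterLin.epiRot ψ) ∧ OuterLin.hypoRot f ∈ OuterLin.LCc n ∧
      (2 ≤ n → OuterLin.conj (OuterLin.epiRot ψ) = OuterLin.conjMean ψ)) ∧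
    -- both extremal problems are well defined
    𝒴 ⊆ OuterLin.admissible (OuterLin.epiRot ψ) ∧
    (∀ Y ∈ 𝒴, ∀ ϑ ∈ Matrix.orthogonalGroup (Fin n) ℝ,
      OuterLin.expNeg (OuterLin.outerLin (OuterLin.rotate ϑ ψ) Y) ∈ OuterLin.LCc n ∧
      OuterLin.expNeg (OuterLin.outerLin (OuterLin.rotate ϑ (OuterLin.epiRot ψ)) Y)
        ∈ OuterLin.LCc n) ∧
    -- the extremal inequality
    OuterLin.Fstar F f 𝒴 ≤ OuterLin.Fstar F (OuterLin.hypoRot f) 𝒴 := by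
  subst hf
  have hrot := hψ.epiRot
  have h𝒴' := h𝒴.trans (OuterLin.admissible_subset_epiRot hψ)
  have hhypo : OuterLin.hypoRot (OuterLin.expNeg ψ) = OuterLin.expNeg (OuterLin.epiRot ψ) := by
    rw [OuterLin.hypoRot, OuterLin.negLog_expNeg]
  rw [hhypo]
  refine ⟨⟨hrot, OuterLin.expNeg_mem_LCc hrot, fun h2 =>
    OuterLin.conj_epiRot_of_ne_one (by omega) hψ⟩, h𝒴', fun Y hY ϑ hϑ => ⟨?_, ?_⟩, ?_⟩
  · exact OuterLin.expNeg_mem_LCc (OuterLin.isConvC_outerLin_rotate hn hψ (h𝒴 hY) hϑ)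
  · exact OuterLin.expNeg_mem_LCc (OuterLin.isConvC_outerLin_rotate hn hrot (h𝒴' hY) hϑ)
  · exact OuterLin.Fstar_le_of_isMotionMean hn hF_usc hF_logconcave hF_mono hψ hrot
      (OuterLin.isMotionMean_epiRot hψ) h𝒴 h𝒴'
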